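/- **Conventions.** $V^0$ is the theory in the two-sorted vocabulary $\{0,1,+,\cdot,|\ |;=_1,=_2,\le,\in\}$ (numbers and finite sets of numbers) axiomatized by 2-BASIC (the axioms B1–B12 for numbers, and L1, L2, SE for sets) and the comprehension scheme $\exists X\,(|X|\le y\wedge\forall z<y\,(X(z)\leftrightarrow\psi(z)))$ for all $\Sigma^B_0$-formulas $\psi$ (all quantifiers are bounded number quantifiers) not containing $X$. "$V^0$ proves $\sigma$" means that $\sigma$ is a logical consequence of these axioms. Tuples of numbers are coded by iterating $\langle x,y\rangle=\frac{(x+y)(x+y+1)}2+x$. A CNF formula $\varphi=C_1\wedge\dots\wedge C_n$ over $x_1,\dots,x_m$ is coded by the graph of the function $\{1,\dots,n\}\times\{1,\dots,m\}\to\{-1,0,1\}$ whose value at $(i,j)$ is $1$ if $x_j\in C_i$, $-1$ if $\neg x_j\in C_i$, and $0$ otherwise; an assignment $\mathbf a\in\{0,1\}^m$ is coded by its graph. **The automaton $A_\varphi$.** Let $n$ be odd (if $n$ is even, $\varphi$ is first replaced by $\varphi$ with one more copy of its last clause, and $n$ by $n+1$). A state is a tuple $s=((i,j),\mathrm{flag},a,\mathsf{pd},\mathsf{pc},\mathrm{label})$,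 where $\square$ marks an absent component. The set $S_{n,m}$ consists of the quiescent state $\mathbf q$ (all components $\square$) and of the states with label in $\{0,1\}$, coordinates $(i,j)\in\{0,\dots,n\}\times\{0,\dots,m+1\}$ and, as only other components different from $\square$: none if $j=0$ or $(i,j)=(0,m+1)$; $a\in\{0,1\}$ if $i=0$, $1\le j\le m$; $\mathsf{pc}\in\{0,1\}$ if $i\ge1$, $j=m+1$; $\mathrm{flag}\in\{-1,0,1\}$ and $a,\mathsf{pd}\in\{0,1\}$ if $i\ge 1$, $1\le j\le m$. $\mathrm{Config}_{n,m}$ is the set of maps $C:\{0,\dots,n\}\times\{0,\dots,m+1\}\to S_{n,m}\setminus\{\mathbf q\}$; all cells outside the rectangle are in state $\mathbf q$. The right, left, below and above neighbours of the cell $(i,j)$ are $(i,j+1)$, $(i,j-1)$, $(i+1,j)$, $(i-1,j)$. A cell with state $s\ne\mathbf q$, $\mathrm{coord}(s)=(i,j)$, is *locally correct* if * (A) the right, left, below, above neighbour has written coordinates $(i,j+1)$, $(i,j-1)$, $(i+1,j)$, $(i-1,j)$, respectively, if this pair lies in $\{0,\dots,n\}\times\{0,\dots,m+1\}$, and is in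 state $\mathbf q$ otherwise; * (B) if $1\le i\le n$ and $1\le j\le m$, then $\mathrm{flag}(s)$ is $1$, $-1$, $0$ iff, respectively, $x_j\in C_i$, $\neg x_j\in C_i$, neither; * (C) if $1\le j\le m$, every non-quiescent below or above neighbour has the same $a$-component; if $j=m+1$, $i\ge2$, then $\mathsf{pc}(s)=\mathsf{pc}(\text{above})\wedge\mathsf{pd}(\text{left})$; if $(i,j)=(1,m+1)$, then $\mathsf{pc}(s)=\mathsf{pd}(\text{left})$; * (D) if $i\ge1$ and $1\le j\le m$, then $\mathsf{pd}(s)=1$ iff ($\mathrm{flag}(s)=1\wedge a(s)=1$) or ($\mathrm{flag}(s)=-1\wedge a(s)=0$) or ($j\ge2$ and $\mathsf{pd}(\text{left})=1$); * (E) the components that are absent from the states with coordinates $(i,j)$ are $\square$. The cell is *blue* if it is locally correct and, in case $(i,j)=(n,m+1)$, $\mathsf{pc}(s)=1$. Put $\mathrm{suc}(i,j)=(i,j+1)$ if $(i,j)=(0,0)$ or $i$ is even and $1\le j\le m$; $(i,j-1)$ if $(i,j)=(n,1)$ or $i$ is odd and $2\le j\le m+1$; $(i+1,j)$ if $i$ is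 odd, $j=1$, $i\neq n$, or $i$ is even and $j=m+1$; $(i-1,j)$ if $i\ge1$ and $j=0$. The local function $f_\varphi:S_{n,m}^5\to S_{n,m}$ maps the states $(s_1,\dots,s_5)$ of a cell and of its right, left, below and above neighbours to $s_1$ if the cell is not blue, and otherwise to $s_1$ with its label replaced by $\mathrm{label}(s_1)\oplus\mathrm{label}(s_k)$, where $s_k$ is the neighbour state with $\mathrm{coord}(s_k)=\mathrm{suc}(i,j)$. $A_\varphi$ is the two-dimensional cellular automaton with states $S_{n,m}$, the von Neumann neighbourhood and local function $f_\varphi$, acting on $\mathrm{Config}_{n,m}$. In $V^0$, it is given by the set $S_{n,m}$ and by the graph of $f_\varphi$, and configurations are given by their graphs. **Theorem.** $V^0$ proves: for all $n\ge1$, all $m$ and every CNF formula $\varphi$ with $n$ clauses and $m$ variables, the automaton $A_\varphi$ exists (that is, the sets coding $S_{n,m}$ and $f_\varphi$ exist), and if $A_\varphi$ is injective on $\mathrm{Config}_{n,m}$ (that is, for all $C,C',D\in\mathrm{Config}_{n,m}$, if $A_\varphi(C)=D$ and $A_\varphi(C')=D$, then $C=C'$), then $\varphi$ is unsatisfiable: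 no $\mathbf a\in\{0,1\}^m$ satisfies every clause of $\varphi$. -/

import Mathlib

universe u

namespace TwoSorted

/-! ## Two-sorted first-order logic over the vocabulary `0, 1, +, ·, | |; =₁, =₂, ≤, ∈` -/

/-- Number terms in the free number variables `x 0, …, x (a-1)` and the free set variables
`X 0, …, X (b-1)`. -/
inductive Tm (a b : ℕ) : Type
  | var (i : Fin a) : Tm a b
  | zero : Tm a b
  | one : Tm a b
  | add (s t : Tm a b) : Tm a b
  | mul (s t : Tm a b) : Tm a b
  | len (X : Fin b) : Tm a b

instance {a b : ℕ} : Zero (Tm a b) := ⟨Tm.zero⟩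
instance {a b : ℕ} : One (Tm a b) := ⟨Tm.one⟩
instance {a b : ℕ} : Add (Tm a b) := ⟨Tm.add⟩
instance {a b : ℕ} : Mul (Tm a b) := ⟨Tm.mul⟩

/-- Formulas with free number variables `x 0, …, x (a-1)` and free set variables
`X 0, …, X (b-1)`. A quantifier over numbers binds the variable `x a` of its body, a quantifier
over sets binds the variable `X b` of its body. -/
inductive Fml : ℕ → ℕ → Type
  | eqN {a b : ℕ} (s t : Tm a b) : Fml a b
  | eqS {a b : ℕ} (X Y : Fin b) : Fml a b
  | le {a b : ℕ} (s t : Tm a b) : Fml a b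
  | mem {a b : ℕ} (t : Tm a b) (X : Fin b) : Fml a b
  | not {a b : ℕ} (φ : Fml a b) : Fml a b
  | and {a b : ℕ} (φ ψ : Fml a b) : Fml a b
  | or {a b : ℕ} (φ ψ : Fml a b) : Fml a b
  | allN {a b : ℕ} (φ : Fml (a + 1) b) : Fml a b
  | exN {a b : ℕ} (φ : Fml (a + 1) b) : Fml a b
  | allS {a b : ℕ} (φ : Fml a (b + 1)) : Fml a b
  | exS {a b : ℕ} (φ : Fml a (b + 1)) : Fml a b

/-- The number variable with index `i`. -/
abbrev x {a b : ℕ} (i : ℕ) (h : i < a := by omega) : Tm a b := Tm.var ⟨i, h⟩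

/-- The set variable with index `i`. -/
abbrev X {b : ℕ} (i : ℕ) (h : i < b := by omega) : Fin b := ⟨i, h⟩

/-- Simultaneous substitution of terms for number variables and of set variables for set
variables, in a term. -/
def Tm.subst {a b a' b' : ℕ} (σ : Fin a → Tm a' b') (τ : Fin b → Fin b') : Tm a b → Tm a' b'
  | .var i => σ i
  | .zero => .zero
  | .one => .one
  | .add s t => .add (s.subst σ τ) (t.subst σ τ)
  | .mul s t => .mul (s.subst σ τ) (t.subst σ τ)
  | .len Y => .len (τ Y)

/-- The same term, seen in a context with one more number variable. -/
def Tm.liftN {a b : ℕ} (t : Tm a b) : Tm (a + 1) b := t.subst (fun i => .var i.castSucc) id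

/-- The same term, seen in a context with one more set variable. -/
def Tm.liftS {a b : ℕ} (t : Tm a b) : Tm a (b + 1) := t.subst .var Fin.castSucc

/-- Simultaneous (capture-free) substitution in a formula. `φ.app ![t₀, t₁, …] ![Y₀, Y₁, …]` is
`φ(t₀, t₁, …; Y₀, Y₁, …)`. -/
def Fml.app {a b a' b' : ℕ} (φ : Fml a b) (σ : Fin a → Tm a' b') (τ : Fin b → Fin b') :
    Fml a' b' :=
  match φ with
  | .eqN s t => .eqN (s.subst σ τ) (t.subst σ τ)
  | .eqS Y Z => .eqS (τ Y) (τ Z)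
  | .le s t => .le (s.subst σ τ) (t.subst σ τ)
  | .mem t Y => .mem (t.subst σ τ) (τ Y)
  | .not φ => .not (φ.app σ τ)
  | .and φ ψ => .and (φ.app σ τ) (ψ.app σ τ)
  | .or φ ψ => .or (φ.app σ τ) (ψ.app σ τ)
  | .allN φ => .allN (φ.app (Fin.snoc (fun i => (σ i).liftN) (.var (Fin.last _))) τ)
  | .exN φ => .exN (φ.app (Fin.snoc (fun i => (σ i).liftN) (.var (Fin.last _))) τ)
  | .allS φ => .allS (φ.app (fun i => (σ i).liftS) (Fin.snoc (fun i => (τ i).castSucc) (Fin.last _)))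
  | .exS φ => .exS (φ.app (fun i => (σ i).liftS) (Fin.snoc (fun i => (τ i).castSucc) (Fin.last _)))

/-- Implication. -/
def Fml.imp {a b : ℕ} (φ ψ : Fml a b) : Fml a b := .or (.not φ) ψ

/-- Equivalence. -/
def Fml.iff {a b : ℕ} (φ ψ : Fml a b) : Fml a b := .and (φ.imp ψ) (ψ.imp φ)

/-- `s < t` abbreviates `s ≤ t ∧ s ≠ t`. -/
def Fml.lt {a b : ℕ} (s t : Tm a b) : Fml a b := .and (.le s t) (.not (.eqN s t))

/-- The bounded quantifier `∃ y ≤ t, φ(y)`. -/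
def Fml.exB {a b : ℕ} (t : Tm a b) (φ : Fml (a + 1) b) : Fml a b :=
  .exN (.and (.le (.var (Fin.last a)) t.liftN) φ)

/-- The bounded quantifier `∀ y ≤ t, φ(y)`. -/
def Fml.allB {a b : ℕ} (t : Tm a b) (φ : Fml (a + 1) b) : Fml a b :=
  .allN (.imp (.le (.var (Fin.last a)) t.liftN) φ)

infix:50 " ≐ " => Fml.eqN
infix:50 " ⩽ " => Fml.le
prefix:60 "⌐" => Fml.not
infixr:35 " ⋏ " => Fml.and
infixr:30 " ⋎ " => Fml.or
infixr:25 " ⇾ " => Fml.imp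
infix:20 " ⇿ " => Fml.iff

/-- A two-sorted structure. Equality of either sort is interpreted as true equality. -/
structure Struct : Type (u + 1) where
  Num : Type u
  Sets : Type u
  zero : Num
  one : Num
  add : Num → Num → Num
  mul : Num → Num → Num
  len : Sets → Num
  le : Num → Num → Prop
  mem : Num → Sets → Prop

/-- The value of a term. -/
def Tm.eval (M : Struct.{u}) {a b : ℕ} (v : Fin a → M.Num) (V : Fin b → M.Sets) :
    Tm a b → M.Num
  | .var i => v i
  | .zero => M.zero
  | .one => M.one
  | .add s t => M.add (s.eval M v V) (t.eval M v V)
  | .mul s t => M.mul (s.eval M v V) (t.eval M v V)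
  | .len Y => M.len (V Y)

/-- Tarskian truth of a formula in a structure under an assignment. -/
def Fml.Holds (M : Struct.{u}) {a b : ℕ} (φ : Fml a b) (v : Fin a → M.Num)
    (V : Fin b → M.Sets) : Prop :=
  match φ with
  | .eqN s t => s.eval M v V = t.eval M v V
  | .eqS Y Z => V Y = V Z
  | .le s t => M.le (s.eval M v V) (t.eval M v V)
  | .mem t Y => M.mem (t.eval M v V) (V Y)
  | .not φ => ¬ φ.Holds M v V
  | .and φ ψ => φ.Holds M v V ∧ ψ.Holds M v V
  | .or φ ψ => φ.Holds M v V ∨ ψ.Holds M v V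
  | .allN φ => ∀ d : M.Num, φ.Holds M (Fin.snoc v d) V
  | .exN φ => ∃ d : M.Num, φ.Holds M (Fin.snoc v d) V
  | .allS φ => ∀ D : M.Sets, φ.Holds M v (Fin.snoc V D)
  | .exS φ => ∃ D : M.Sets, φ.Holds M v (Fin.snoc V D)

/-- A theory is given by a set of axioms; the free variables of an axiom are understood to be
universally quantified. -/
abbrev Theory : Type := ∀ a b : ℕ, Set (Fml a b)

/-- `M` is a model of `T`. -/
def Struct.IsModel (M : Struct.{u}) (T : Theory) : Prop :=
  ∀ (a b : ℕ) (φ : Fml a b), φ ∈ T a b → ∀ (v : Fin a → M.Num) (V : Fin b → M.Sets), φ.Holds M v V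

/-- `T ⊢ σ`, for a sentence `σ`: it is a logical consequence of `T`. -/
def Theory.Proves (T : Theory) (σ : Fml 0 0) : Prop :=
  ∀ M : Struct.{u}, M.IsModel T → σ.Holds M Fin.elim0 Fin.elim0

/-! ## The theory `V⁰` -/

/-- The axioms of 2-BASIC. -/
inductive IsTwoBasic : ∀ {a b : ℕ}, Fml a b → Prop
  | B1 : IsTwoBasic (a := 1) (b := 0) (⌐(x 0 + 1 ≐ 0))
  | B2 : IsTwoBasic (a := 2) (b := 0) (x 0 + 1 ≐ x 1 + 1 ⇾ x 0 ≐ x 1)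
  | B3 : IsTwoBasic (a := 1) (b := 0) (x 0 + 0 ≐ x 0)
  | B4 : IsTwoBasic (a := 2) (b := 0) (x 0 + (x 1 + 1) ≐ (x 0 + x 1) + 1)
  | B5 : IsTwoBasic (a := 1) (b := 0) (x 0 * 0 ≐ 0)
  | B6 : IsTwoBasic (a := 2) (b := 0) (x 0 * (x 1 + 1) ≐ x 0 * x 1 + x 0)
  | B7 : IsTwoBasic (a := 2) (b := 0) (x 0 ⩽ x 1 ⋏ x 1 ⩽ x 0 ⇾ x 0 ≐ x 1)
  | B8 : IsTwoBasic (a := 2) (b := 0) (x 0 ⩽ x 0 + x 1)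
  | B9 : IsTwoBasic (a := 1) (b := 0) (0 ⩽ x 0)
  | B10 : IsTwoBasic (a := 2) (b := 0) (x 0 ⩽ x 1 ⋎ x 1 ⩽ x 0)
  | B11 : IsTwoBasic (a := 2) (b := 0) (x 0 ⩽ x 1 ⇿ Fml.lt (x 0) (x 1 + 1))
  | B12 : IsTwoBasic (a := 1) (b := 0) (⌐(x 0 ≐ 0) ⇾ Fml.exB (x 0) (x 1 + 1 ≐ x 0))
  | L1 : IsTwoBasic (a := 1) (b := 1) (Fml.mem (x 0) (X 0) ⇾ Fml.lt (x 0) (.len (X 0)))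
  | L2 : IsTwoBasic (a := 1) (b := 1) (x 0 + 1 ≐ .len (X 0) ⇾ Fml.mem (x 0) (X 0))
  | SE : IsTwoBasic (a := 0) (b := 2)
      (.len (X 0) ≐ .len (X 1) ⋏
        Fml.allN (Fml.lt (x 0) (.len (X 0)) ⇾ (Fml.mem (x 0) (X 0) ⇿ Fml.mem (x 0) (X 1))) ⇾
        Fml.eqS (X 0) (X 1))

/-- `Σ₀ᴮ`-formulas: all quantifiers are bounded number quantifiers. -/
inductive IsSigma0B : ∀ {a b : ℕ}, Fml a b → Prop
  | eqN {a b : ℕ} (s t : Tm a b) : IsSigma0B (.eqN s t)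
  | eqS {a b : ℕ} (Y Z : Fin b) : IsSigma0B (a := a) (.eqS Y Z)
  | le {a b : ℕ} (s t : Tm a b) : IsSigma0B (.le s t)
  | mem {a b : ℕ} (t : Tm a b) (Y : Fin b) : IsSigma0B (.mem t Y)
  | not {a b : ℕ} {φ : Fml a b} : IsSigma0B φ → IsSigma0B (.not φ)
  | and {a b : ℕ} {φ ψ : Fml a b} : IsSigma0B φ → IsSigma0B ψ → IsSigma0B (.and φ ψ)
  | or {a b : ℕ} {φ ψ : Fml a b} : IsSigma0B φ → IsSigma0B ψ → IsSigma0B (.or φ ψ)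
  | exB {a b : ℕ} (t : Tm a b) {φ : Fml (a + 1) b} : IsSigma0B φ → IsSigma0B (.exB t φ)
  | allB {a b : ℕ} (t : Tm a b) {φ : Fml (a + 1) b} : IsSigma0B φ → IsSigma0B (.allB t φ)

/-- The comprehension axiom `∃ Y ≤ y ∀ z < y (Y(z) ↔ φ(z))`. Here `y` is `x a`, `z` is
`x (a+1)`, and `Y` is `X b`, which does not occur in `φ`. -/
def comprehension {a b : ℕ} (φ : Fml (a + 2) b) : Fml (a + 1) b :=
  .exS (.len (X b) ⩽ x a ⋏
    .allN (Fml.lt (x (a + 1)) (x a) ⇾ (Fml.mem (x (a + 1)) (X b) ⇿ φ.app .var Fin.castSucc)))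

/-- The axioms of the scheme `Σ₀ᴮ`-COMP. -/
inductive IsComprehension : ∀ {a b : ℕ}, Fml a b → Prop
  | mk {a b : ℕ} (φ : Fml (a + 2) b) : IsSigma0B φ → IsComprehension (comprehension φ)

/-- The theory `V⁰`. -/
def V0 : Theory := fun _ _ => {φ | IsTwoBasic φ ∨ IsComprehension φ}

/-! ## Coding of tuples, CNF formulas and assignments -/

/-- `⟨x 0, x 1⟩ = x 2` for `⟨x, y⟩ = (x + y)(x + y + 1) / 2 + x`. -/
def pair : Fml 3 0 := (x 0 + x 1) * (x 0 + x 1 + 1) + (x 0 + x 0) ≐ x 2 + x 2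

/-- `⟨x 0, ⟨x 1, x 2⟩⟩ = x 3`. -/
def triple : Fml 4 0 := .exB (x 3) (pair.app ![x 1, x 2, x 4] ![] ⋏ pair.app ![x 0, x 4, x 3] ![])

/-- `⟨x 0, ⟨x 1, ⟨x 2, ⟨x 3, ⟨x 4, x 5⟩⟩⟩⟩⟩ = x 6`. -/
def sextuple : Fml 7 0 :=
  .exB (x 6) (.exB (x 6) (.exB (x 6) (.exB (x 6)
    (pair.app ![x 4, x 5, x 7] ![] ⋏ pair.app ![x 3, x 7, x 8] ![] ⋏ pair.app ![x 2, x 8, x 9] ![] ⋏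
      pair.app ![x 1, x 9, x 10] ![] ⋏ pair.app ![x 0, x 10, x 6] ![]))))

/-- `(x 0, x 1) ∈ X 0`. -/
def inRel2 : Fml 2 1 := .exB (.len (X 0)) (pair.app ![x 0, x 1, x 2] ![] ⋏ .mem (x 2) (X 0))

/-- `(x 0, x 1, x 2) ∈ X 0`. -/
def inRel3 : Fml 3 1 :=
  .exB (.len (X 0)) (triple.app ![x 0, x 1, x 2, x 3] ![] ⋏ .mem (x 3) (X 0))

/-- The number that codes the flag `-1` (the flags `0` and `1` are coded by themselves). -/
def minusOne {a b : ℕ} : Tm a b := 1 + 1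

/-- `s ≤ t ∧ t ≤ r`. -/
def between {a b : ℕ} (s t r : Tm a b) : Fml a b := s ⩽ t ⋏ t ⩽ r

/-- `CNF(n, m, R)` with `n = x 0`, `m = x 1`, `R = X 0`: the set `R` is the graph of a function
`{1,…,n} × {1,…,m} → {-1, 0, 1}`. The value at `(i, j)` is `1` if `x_j ∈ C_i`, it is `-1` if
`¬x_j ∈ C_i`, and `0` otherwise. -/
def cnf : Fml 2 1 :=
  .allN (.mem (x 2) (X 0) ⇾
    .exB (x 0) (.exB (x 1) (.exB (1 + 1)
      (1 ⩽ x 3 ⋏ 1 ⩽ x 4 ⋏ triple.app ![x 3, x 4, x 5, x 2] ![])))) ⋏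
  .allB (x 0) (.allB (x 1) (1 ⩽ x 2 ⋏ 1 ⩽ x 3 ⇾
    .exB (1 + 1) (inRel3.app ![x 2, x 3, x 4] ![X 0]) ⋏
    .allB (1 + 1) (.allB (1 + 1)
      (inRel3.app ![x 2, x 3, x 4] ![X 0] ⋏ inRel3.app ![x 2, x 3, x 5] ![X 0] ⇾ x 4 ≐ x 5))))

/-- `X 0` is an assignment `(a_1, …, a_m) ∈ {0,1}^m` with `m = x 0`, that is, the graph of a
function `{1,…,m} → {0,1}`. -/
def assignment : Fml 1 1 :=
  .allN (.mem (x 1) (X 0) ⇾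
    .exB (x 0) (.exB 1 (1 ⩽ x 2 ⋏ pair.app ![x 2, x 3, x 1] ![]))) ⋏
  .allB (x 0) (1 ⩽ x 1 ⇾
    .exB 1 (inRel2.app ![x 1, x 2] ![X 0]) ⋏
    .allB 1 (.allB 1
      (inRel2.app ![x 1, x 2] ![X 0] ⋏ inRel2.app ![x 1, x 3] ![X 0] ⇾ x 2 ≐ x 3)))

/-- `Sat(n, m, a, R)` with `n = x 0`, `m = x 1`, `R = X 0`, `a = X 1`: every clause `C_i`
contains a literal that is true under `a`. -/
def sat : Fml 2 2 :=
  .allB (x 0) (1 ⩽ x 2 ⇾ .exB (x 1) (1 ⩽ x 3 ⋏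
    (inRel3.app ![x 2, x 3, 1] ![X 0] ⋏ inRel2.app ![x 3, 1] ![X 1] ⋎
     inRel3.app ![x 2, x 3, minusOne] ![X 0] ⋏ inRel2.app ![x 3, 0] ![X 1])))

/-- `x 0` is even. -/
def even : Fml 1 0 := .exB (x 0) (x 0 ≐ x 1 + x 1)

/-- `x 0` is odd. -/
def odd : Fml 1 0 := .exB (x 0) (x 0 ≐ x 1 + x 1 + 1)

/-- With `n = x 0`, `m = x 1`, `n' = x 2`, `R = X 0`, `R' = X 1`: the formula `R'` with `n'`
clauses is `R` if `n` is odd, and is `R` with one more copy of its last clause if `n` is even. -/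
def oddForm : Fml 3 2 :=
  odd.app ![x 0] ![] ⋏ x 2 ≐ x 0 ⋏ .eqS (X 1) (X 0) ⋎
  even.app ![x 0] ![] ⋏ x 2 ≐ x 0 + 1 ⋏ .allN (.mem (x 3) (X 1) ⇿
    (.mem (x 3) (X 0) ⋎ .exB (x 1) (.exB (1 + 1)
      (inRel3.app ![x 0, x 4, x 5] ![X 0] ⋏ triple.app ![x 2, x 4, x 5, x 3] ![]))))

/-! ## The states

A state is a tuple `((i, j), flag, a, pd, pc, label)`. A component that is absent (`□`) is coded
by `0`, a component with value `v` is coded by `v + 1`. -/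

/-- The code of `□`. -/
def box {a b : ℕ} : Tm a b := 0

/-- The code of a component with value `t`. -/
def val {a b : ℕ} (t : Tm a b) : Tm a b := t + 1

/-- `x 7` is the state whose components have the codes `x 0, …, x 6`, that is,
`x 7 = ⟨⟨x 0, x 1⟩, ⟨x 2, ⟨x 3, ⟨x 4, ⟨x 5, x 6⟩⟩⟩⟩⟩`. -/
def tuple : Fml 8 0 :=
  .exB (x 7) (.exB (x 7) (.exB (x 7) (.exB (x 7) (.exB (x 7)
    (pair.app ![x 0, x 1, x 8] ![] ⋏ pair.app ![x 5, x 6, x 9] ![] ⋏ pair.app ![x 4, x 9, x 10] ![] ⋏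
      pair.app ![x 3, x 10, x 11] ![] ⋏ pair.app ![x 2, x 11, x 12] ![] ⋏
      pair.app ![x 8, x 12, x 7] ![])))))

/-- `x 0 = q`, the quiescent state. -/
def quiescent : Fml 1 0 := tuple.app ![box, box, box, box, box, box, box, x 0] ![]

/-- `coord(s) = (i, j)` with `i = x 0`, `j = x 1`, `s = x 2` (both coordinates are numbers). -/
def coordIs : Fml 3 0 :=
  .exB (x 2) (.exB (x 2) (.exB (x 2) (.exB (x 2) (.exB (x 2)
    (tuple.app ![val (x 0), val (x 1), x 3, x 4, x 5, x 6, x 7, x 2] ![])))))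

/-- The component `flag(s)` of `s = x 1` has the code `x 0`. -/
def flagIs : Fml 2 0 :=
  .exB (x 1) (.exB (x 1) (.exB (x 1) (.exB (x 1) (.exB (x 1) (.exB (x 1)
    (tuple.app ![x 2, x 3, x 0, x 4, x 5, x 6, x 7, x 1] ![]))))))

/-- The component `a(s)` of `s = x 1` has the code `x 0`. -/
def aIs : Fml 2 0 :=
  .exB (x 1) (.exB (x 1) (.exB (x 1) (.exB (x 1) (.exB (x 1) (.exB (x 1)
    (tuple.app ![x 2, x 3, x 4, x 0, x 5, x 6, x 7, x 1] ![]))))))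

/-- The component `pd(s)` of `s = x 1` has the code `x 0`. -/
def pdIs : Fml 2 0 :=
  .exB (x 1) (.exB (x 1) (.exB (x 1) (.exB (x 1) (.exB (x 1) (.exB (x 1)
    (tuple.app ![x 2, x 3, x 4, x 5, x 0, x 6, x 7, x 1] ![]))))))

/-- The component `pc(s)` of `s = x 1` has the code `x 0`. -/
def pcIs : Fml 2 0 :=
  .exB (x 1) (.exB (x 1) (.exB (x 1) (.exB (x 1) (.exB (x 1) (.exB (x 1)
    (tuple.app ![x 2, x 3, x 4, x 5, x 6, x 0, x 7, x 1] ![]))))))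

/-- The component `label(s)` of `s = x 1` has the code `x 0`. -/
def labelIs : Fml 2 0 :=
  .exB (x 1) (.exB (x 1) (.exB (x 1) (.exB (x 1) (.exB (x 1) (.exB (x 1)
    (tuple.app ![x 2, x 3, x 4, x 5, x 6, x 7, x 0, x 1] ![]))))))

/-- `t` is the code of `0` or of `1`. -/
def isBit {a b : ℕ} (t : Tm a b) : Fml a b := t ≐ val 0 ⋎ t ≐ val 1

/-- `x 2 ∈ S_{n,m}` with `n = x 0`, `m = x 1`. In the body, `x 3, …, x 9` are the codes of the
components `i, j, flag, a, pd, pc, label`. The disjuncts are: top-left cell, `0`th column, `0`th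
row, top-right cell, last column, main body; quiescent state. -/
def isState : Fml 3 0 :=
  .exB (x 2) (.exB (x 2) (.exB (x 2) (.exB (x 2) (.exB (x 2) (.exB (x 2) (.exB (x 2)
    (tuple.app ![x 3, x 4, x 5, x 6, x 7, x 8, x 9, x 2] ![] ⋏
      (isBit (x 9) ⋏
        (x 3 ≐ val 0 ⋏ x 4 ≐ val 0 ⋏ x 5 ≐ box ⋏ x 6 ≐ box ⋏ x 7 ≐ box ⋏ x 8 ≐ box ⋎
         between (val 1) (x 3) (val (x 0)) ⋏ x 4 ≐ val 0 ⋏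
            x 5 ≐ box ⋏ x 6 ≐ box ⋏ x 7 ≐ box ⋏ x 8 ≐ box ⋎
         x 3 ≐ val 0 ⋏ between (val 1) (x 4) (val (x 1)) ⋏
            x 5 ≐ box ⋏ isBit (x 6) ⋏ x 7 ≐ box ⋏ x 8 ≐ box ⋎
         x 3 ≐ val 0 ⋏ x 4 ≐ val (x 1 + 1) ⋏ x 5 ≐ box ⋏ x 6 ≐ box ⋏ x 7 ≐ box ⋏ x 8 ≐ box ⋎
         between (val 1) (x 3) (val (x 0)) ⋏ x 4 ≐ val (x 1 + 1) ⋏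
            x 5 ≐ box ⋏ x 6 ≐ box ⋏ x 7 ≐ box ⋏ isBit (x 8) ⋎
         between (val 1) (x 3) (val (x 0)) ⋏ between (val 1) (x 4) (val (x 1)) ⋏
            (x 5 ≐ val minusOne ⋎ x 5 ≐ val 0 ⋎ x 5 ≐ val 1) ⋏ isBit (x 6) ⋏ isBit (x 7) ⋏
            x 8 ≐ box) ⋎
       x 3 ≐ box ⋏ x 4 ≐ box ⋏ x 5 ≐ box ⋏ x 6 ≐ box ⋏ x 7 ≐ box ⋏ x 8 ≐ box ⋏
        x 9 ≐ box))))))))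

/-- `X 0 = S_{n,m}` with `n = x 0`, `m = x 1`. -/
def isStateSet : Fml 2 1 := .allN (.mem (x 2) (X 0) ⇿ isState.app ![x 0, x 1, x 2] ![])

/-! ## The local correctness rules

Number variables: `n = x 0`, `m = x 1`, the state `s` of the cell is `x 2`, the states of its
right, left, below and above neighbours are `x 3`, `x 4`, `x 5`, `x 6`, and `coord(s) = (i, j)`
with `i = x 7`, `j = x 8`. Set variable: the formula `R = X 0`. -/

/-- Index consistency: the neighbours inside the table carry the right coordinates, those
outside are quiescent. -/
def ruleA : Fml 9 1 :=
  (x 8 ⩽ x 1 ⇾ coordIs.app ![x 7, x 8 + 1, x 3] ![]) ⋏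
  (x 8 ≐ x 1 + 1 ⇾ quiescent.app ![x 3] ![]) ⋏
  .allB (x 8) (x 9 + 1 ≐ x 8 ⇾ coordIs.app ![x 7, x 9, x 4] ![]) ⋏
  (x 8 ≐ 0 ⇾ quiescent.app ![x 4] ![]) ⋏
  (Fml.lt (x 7) (x 0) ⇾ coordIs.app ![x 7 + 1, x 8, x 5] ![]) ⋏
  (x 7 ≐ x 0 ⇾ quiescent.app ![x 5] ![]) ⋏
  .allB (x 7) (x 9 + 1 ≐ x 7 ⇾ coordIs.app ![x 9, x 8, x 6] ![]) ⋏
  (x 7 ≐ 0 ⇾ quiescent.app ![x 6] ![])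

/-- Formula consistency. -/
def ruleB : Fml 9 1 :=
  between 1 (x 7) (x 0) ⋏ between 1 (x 8) (x 1) ⇾
    (flagIs.app ![val 1, x 2] ![] ⇿ inRel3.app ![x 7, x 8, 1] ![X 0]) ⋏
    (flagIs.app ![val minusOne, x 2] ![] ⇿ inRel3.app ![x 7, x 8, minusOne] ![X 0]) ⋏
    (flagIs.app ![val 0, x 2] ![] ⇿
      ⌐(inRel3.app ![x 7, x 8, 1] ![X 0]) ⋏ ⌐(inRel3.app ![x 7, x 8, minusOne] ![X 0]))

/-- The `a`-value is constant along a column (inside the table). -/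
def ruleC1 : Fml 9 1 :=
  between 1 (x 8) (x 1) ⇾
    (⌐(quiescent.app ![x 5] ![]) ⇾
      .exB (1 + 1) (aIs.app ![x 9, x 5] ![] ⋏ aIs.app ![x 9, x 2] ![])) ⋏
    (⌐(quiescent.app ![x 6] ![]) ⇾
      .exB (1 + 1) (aIs.app ![x 9, x 6] ![] ⋏ aIs.app ![x 9, x 2] ![]))

/-- `pc(s) = pc(above) ∧ pd(left)` in the last column, from row `2` on. -/
def ruleC2 : Fml 9 1 :=
  1 + 1 ⩽ x 7 ⋏ x 8 ≐ x 1 + 1 ⇾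
    (pcIs.app ![val 1, x 2] ![] ⇿ pcIs.app ![val 1, x 6] ![] ⋏ pdIs.app ![val 1, x 4] ![])

/-- `pc(s) = pd(left)` in the last column, row `1`. -/
def ruleC3 : Fml 9 1 :=
  x 7 ≐ 1 ⋏ x 8 ≐ x 1 + 1 ⇾ (pcIs.app ![val 1, x 2] ![] ⇿ pdIs.app ![val 1, x 4] ![])

/-- `(flag(s) = 1 ∧ a(s) = 1) ∨ (flag(s) = -1 ∧ a(s) = 0)`. -/
def literalTrue : Fml 9 1 :=
  flagIs.app ![val 1, x 2] ![] ⋏ aIs.app ![val 1, x 2] ![] ⋎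
  flagIs.app ![val minusOne, x 2] ![] ⋏ aIs.app ![val 0, x 2] ![]

/-- `pd(s) = pd(left) ∨ literalTrue` in the main body, from column `2` on. -/
def ruleD1 : Fml 9 1 :=
  between 1 (x 7) (x 0) ⋏ between (1 + 1) (x 8) (x 1) ⇾
    (pdIs.app ![val 1, x 2] ![] ⇿ (pdIs.app ![val 1, x 4] ![] ⋎ literalTrue))

/-- `pd(s) = literalTrue` in column `1`. -/
def ruleD2 : Fml 9 1 :=
  between 1 (x 7) (x 0) ⋏ x 8 ≐ 1 ⇾ (pdIs.app ![val 1, x 2] ![] ⇿ literalTrue)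

/-- Technical conditions. -/
def ruleE : Fml 9 1 :=
  (x 8 ≐ 0 ⋎ x 7 ≐ 0 ⋏ x 8 ≐ x 1 + 1 ⇾
    flagIs.app ![box, x 2] ![] ⋏ aIs.app ![box, x 2] ![] ⋏
    pdIs.app ![box, x 2] ![] ⋏ pcIs.app ![box, x 2] ![]) ⋏
  (x 7 ≐ 0 ⋏ between 1 (x 8) (x 1) ⇾
    flagIs.app ![box, x 2] ![] ⋏ pdIs.app ![box, x 2] ![] ⋏ pcIs.app ![box, x 2] ![]) ⋏
  (1 ⩽ x 7 ⋏ x 8 ≐ x 1 + 1 ⇾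
    flagIs.app ![box, x 2] ![] ⋏ aIs.app ![box, x 2] ![] ⋏ pdIs.app ![box, x 2] ![]) ⋏
  (between 1 (x 7) (x 0) ⋏ between 1 (x 8) (x 1) ⇾ pcIs.app ![box, x 2] ![])

/-- A cell in state `x 2` is locally correct: it is not quiescent, and satisfies the rules. -/
def locallyCorrect : Fml 7 1 :=
  .exB (x 0) (.exB (x 1 + 1) (coordIs.app ![x 7, x 8, x 2] ![] ⋏
    ruleA ⋏ ruleB ⋏ ruleC1 ⋏ ruleC2 ⋏ ruleC3 ⋏ ruleD1 ⋏ ruleD2 ⋏ ruleE))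

/-- The cell is blue: it is locally correct, and `pc` is `1` if it is an output cell. -/
def blue : Fml 7 1 :=
  locallyCorrect ⋏ (coordIs.app ![x 0, x 1 + 1, x 2] ![] ⇾ pcIs.app ![val 1, x 2] ![])

/-! ## The local transition function -/

/-- `suc(i, j) = (i', j')` with `n, m, i, j, i', j' = x 0, …, x 5`. The disjuncts are the
directions right, left, down, up. -/
def suc : Fml 6 0 :=
  (x 2 ≐ 0 ⋏ x 3 ≐ 0 ⋎ even.app ![x 2] ![] ⋏ between 1 (x 3) (x 1)) ⋏
    x 4 ≐ x 2 ⋏ x 5 ≐ x 3 + 1 ⋎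
  (x 2 ≐ x 0 ⋏ x 3 ≐ 1 ⋎ odd.app ![x 2] ![] ⋏ between (1 + 1) (x 3) (x 1 + 1)) ⋏
    x 4 ≐ x 2 ⋏ x 5 + 1 ≐ x 3 ⋎
  (odd.app ![x 2] ![] ⋏ x 3 ≐ 1 ⋏ ⌐(x 2 ≐ x 0) ⋎ even.app ![x 2] ![] ⋏ x 3 ≐ x 1 + 1) ⋏
    x 4 ≐ x 2 + 1 ⋏ x 5 ≐ x 3 ⋎
  (1 ⩽ x 2 ⋏ x 3 ≐ 0) ⋏ x 4 + 1 ≐ x 2 ⋏ x 5 ≐ x 3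

/-- With `n, m = x 0, x 1`, the state `s = x 2` of a cell, the state `s' = x 3` of a neighbour,
the code `x 4` of `label(s)`: if `coord(s') = suc(coord(s))` then `x 5` is the code of
`label(s) ⊕ label(s')`. -/
def newLabel : Fml 6 0 :=
  .allB (x 0) (.allB (x 1 + 1) (.allB (x 0) (.allB (x 1 + 1) (.allB (x 3)
    (coordIs.app ![x 6, x 7, x 2] ![] ⋏ suc.app ![x 0, x 1, x 6, x 7, x 8, x 9] ![] ⋏
      coordIs.app ![x 8, x 9, x 3] ![] ⋏ labelIs.app ![x 10, x 3] ![] ⇾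
      (x 4 ≐ x 10 ⋏ x 5 ≐ val 0 ⋎ ⌐(x 4 ≐ x 10) ⋏ x 5 ≐ val 1))))))

/-- With `n, m = x 0, x 1`, and the states `x 2, …, x 6` of a cell and of its right, left, below
and above neighbours: `x 7` is the state `x 2` with the label replaced by the direct sum of the
label and the label of the successor. -/
def update : Fml 8 0 :=
  .exB (x 2) (.exB (x 2) (.exB (x 2) (.exB (x 2) (.exB (x 2) (.exB (x 2) (.exB (x 2) (.exB (x 7)
    (tuple.app ![x 8, x 9, x 10, x 11, x 12, x 13, x 14, x 2] ![] ⋏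
      tuple.app ![x 8, x 9, x 10, x 11, x 12, x 13, x 15, x 7] ![] ⋏
      newLabel.app ![x 0, x 1, x 2, x 3, x 14, x 15] ![] ⋏
      newLabel.app ![x 0, x 1, x 2, x 4, x 14, x 15] ![] ⋏
      newLabel.app ![x 0, x 1, x 2, x 5, x 14, x 15] ![] ⋏
      newLabel.app ![x 0, x 1, x 2, x 6, x 14, x 15] ![]))))))))

/-- `f_φ(x 2, …, x 6) = x 7` with `n, m = x 0, x 1` and `φ = X 0`. -/
def transition : Fml 8 1 :=
  blue.app ![x 0, x 1, x 2, x 3, x 4, x 5, x 6] ![X 0] ⋏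
    update.app ![x 0, x 1, x 2, x 3, x 4, x 5, x 6, x 7] ![] ⋎
  ⌐(blue.app ![x 0, x 1, x 2, x 3, x 4, x 5, x 6] ![X 0]) ⋏ x 7 ≐ x 2

/-- `X 2` is the graph of `f_φ`, a set of tuples from `S_{n,m}^6`, with `n, m = x 0, x 1`,
`φ = X 0` and `S_{n,m} = X 1`. -/
def isLocalFunction : Fml 2 3 :=
  .allN (.mem (x 2) (X 2) ⇿
    .exB (x 2) (.exB (x 2) (.exB (x 2) (.exB (x 2) (.exB (x 2) (.exB (x 2)
      (sextuple.app ![x 3, x 4, x 5, x 6, x 7, x 8, x 2] ![] ⋏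
        .mem (x 3) (X 1) ⋏ .mem (x 4) (X 1) ⋏ .mem (x 5) (X 1) ⋏
        .mem (x 6) (X 1) ⋏ .mem (x 7) (X 1) ⋏ .mem (x 8) (X 1) ⋏
        transition.app ![x 0, x 1, x 3, x 4, x 5, x 6, x 7, x 8] ![X 0])))))))

/-- The sets `X 1`, `X 2` are the set of states and the local function of the automaton `A_φ`,
where `φ = X 0` has `n = x 0` clauses and `m = x 1` variables. -/
def isAutomaton : Fml 2 3 :=
  isStateSet.app ![x 0, x 1] ![X 1] ⋏ isLocalFunction.app ![x 0, x 1] ![X 0, X 1, X 2]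

/-! ## Configurations and injectivity -/

/-- `X 1 ∈ Config_{n,m}` with `n, m = x 0, x 1` and `S_{n,m} = X 0`: it is the graph of a
function from `{0,…,n} × {0,…,m+1}` to the non-quiescent states. -/
def isConfig : Fml 2 2 :=
  .allN (.mem (x 2) (X 1) ⇾
    .exB (x 0) (.exB (x 1 + 1) (.exB (x 2)
      (triple.app ![x 3, x 4, x 5, x 2] ![] ⋏ .mem (x 5) (X 0) ⋏
        ⌐(quiescent.app ![x 5] ![]))))) ⋏
  .allB (x 0) (.allB (x 1 + 1)
    (.exN (inRel3.app ![x 2, x 3, x 4] ![X 1]) ⋏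
      .allN (.allN (inRel3.app ![x 2, x 3, x 4] ![X 1] ⋏ inRel3.app ![x 2, x 3, x 5] ![X 1] ⇾
        x 4 ≐ x 5))))

/-- `x 4` is the state of the right neighbour of the cell `(x 2, x 3)` in the configuration
`X 0`, with `n, m = x 0, x 1`; cells outside the table are quiescent. -/
def rightState : Fml 5 1 :=
  x 3 ⩽ x 1 ⋏ inRel3.app ![x 2, x 3 + 1, x 4] ![X 0] ⋎
  x 3 ≐ x 1 + 1 ⋏ quiescent.app ![x 4] ![]

/-- The same for the left neighbour. -/
def leftState : Fml 5 1 :=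
  .exB (x 3) (x 5 + 1 ≐ x 3 ⋏ inRel3.app ![x 2, x 5, x 4] ![X 0]) ⋎
  x 3 ≐ 0 ⋏ quiescent.app ![x 4] ![]

/-- The same for the below neighbour. -/
def belowState : Fml 5 1 :=
  Fml.lt (x 2) (x 0) ⋏ inRel3.app ![x 2 + 1, x 3, x 4] ![X 0] ⋎
  x 2 ≐ x 0 ⋏ quiescent.app ![x 4] ![]

/-- The same for the above neighbour. -/
def aboveState : Fml 5 1 :=
  .exB (x 2) (x 5 + 1 ≐ x 2 ⋏ inRel3.app ![x 5, x 3, x 4] ![X 0]) ⋎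
  x 2 ≐ 0 ⋏ quiescent.app ![x 4] ![]

/-- `A_φ(X 1) = X 2` for configurations `X 1`, `X 2`, where `X 0` is the graph of `f_φ` and
`n, m = x 0, x 1`: at every cell `(x 2, x 3)` of the table, the state in `X 2` is the value of
`f_φ` at the states in `X 1` of the cell and of its right, left, below and above neighbours. -/
def isImage : Fml 2 3 :=
  .allB (x 0) (.allB (x 1 + 1)
    (.allN (.allN (.allN (.allN (.allN (.allN
      (inRel3.app ![x 2, x 3, x 4] ![X 1] ⋏
        rightState.app ![x 0, x 1, x 2, x 3, x 5] ![X 1] ⋏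
        leftState.app ![x 0, x 1, x 2, x 3, x 6] ![X 1] ⋏
        belowState.app ![x 0, x 1, x 2, x 3, x 7] ![X 1] ⋏
        aboveState.app ![x 0, x 1, x 2, x 3, x 8] ![X 1] ⋏
        inRel3.app ![x 2, x 3, x 9] ![X 2] ⇾
        .exB (.len (X 0))
          (sextuple.app ![x 4, x 5, x 6, x 7, x 8, x 9, x 10] ![] ⋏ .mem (x 10) (X 0))))))))))

/-- The automaton with state set `X 0` and local function `X 1` is injective on
`Config_{n,m}`, with `n, m = x 0, x 1`: if `A(C) = D` and `A(C') = D`, then `C = C'`. -/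
def isInjective : Fml 2 2 :=
  .allS (.allS (.allS
    (isConfig.app ![x 0, x 1] ![X 0, X 2] ⋏ isConfig.app ![x 0, x 1] ![X 0, X 3] ⋏
      isConfig.app ![x 0, x 1] ![X 0, X 4] ⋏
      isImage.app ![x 0, x 1] ![X 1, X 2, X 4] ⋏ isImage.app ![x 0, x 1] ![X 1, X 3, X 4] ⇾
      .eqS (X 2) (X 3))))

/-- No assignment satisfies the formula `X 0` with `n = x 0` clauses and `m = x 1` variables. -/
def unsat : Fml 2 1 :=
  ⌐(.exS (assignment.app ![x 1] ![X 1] ⋏ sat.app ![x 0, x 1] ![X 0, X 1]))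

/-- The sentence "for every CNF formula `φ` with `n ≥ 1` clauses and `m` variables, the automaton
`A_φ` exists, and if it is injective on `Config_{n,m}`, then `φ` is unsatisfiable". Here
`n, m = x 0, x 1`, `φ = X 0`; the automaton is built from `X 1`, which has an odd number
`x 2` of clauses; its set of states and its local function are `X 2` and `X 3`. -/
def injectiveImpliesUnsat : Fml 0 0 :=
  .allN (.allN (.allS (1 ⩽ x 0 ⋏ cnf ⇾
    .exN (.exS (.exS (.exS
      (oddForm.app ![x 0, x 1, x 2] ![X 0, X 1] ⋏
        isAutomaton.app ![x 2, x 1] ![X 1, X 2, X 3])))) ⋏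
    .allN (.allS (.allS (.allS
      (oddForm.app ![x 0, x 1, x 2] ![X 0, X 1] ⋏
        isAutomaton.app ![x 2, x 1] ![X 1, X 2, X 3] ⇾
        (isInjective.app ![x 2, x 1] ![X 2, X 3] ⇾ unsat.app ![x 0, x 1] ![X 0]))))))))

end TwoSorted

/-!
Let `M` be a model of `V⁰`. Since `Σ₀ᴮ`-comprehension gives induction for `Σ₀ᴮ`-definable properties
(`Definable.induction`), the numbers of `M` form a discretely ordered commutative semiring on which
the pairing function `pr` is total, injective and monotone. Truth in `M` of each coding formula is
rewritten into a statement about this semiring (the lemmas `holds_…`). For a nonstandard `M` the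
table has a nonstandard number of cells, so that every set used below has to come from comprehension.

*The automaton exists.* The states, and the tuples of the local function, are defined by
`Σ₀ᴮ`-formulas and are bounded, because `pr` is monotone (`exists_stateSet`,
`exists_localFunction`). The formula with an odd number of clauses exists because every number is
even or odd (`exists_oddForm`).

*If `φ` is satisfiable, then the automaton is not injective.* Fix a satisfying assignment and give
every cell the coordinates, flag, `a`-value, partial disjunction and partial conjunction that
belong to it (`cell`). The partial disjunction at `(i, j)` is the bounded quantification "one of the
first `j` literals of the `i`th clause is true", and all partial conjunctions are `1`; so no
recursion is needed, and the configuration is defined by a `Σ₀ᴮ`-formula (`exists_cellConfig`).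
Every cell is then blue (`blue_cell`). Consider this configuration once with all labels `0` and once
with all labels `1`. A blue cell adds the label of its successor to its own label, which gives
`0 ⊕ 0 = 0` in the first case and `1 ⊕ 1 = 0` in the second. Hence both configurations are mapped
to the first one (`transition_cell`, `not_isInjective`). It does not matter here which neighbour is
the successor, so the closed path that `suc` describes plays no role in this direction.
-/

namespace TwoSorted

/-! ### Substitution -/

theorem Tm.eval_subst (M : Struct.{u}) {a b a' b' : ℕ} (σ : Fin a → Tm a' b') (τ : Fin b → Fin b')
    (v : Fin a' → M.Num) (V : Fin b' → M.Sets) (t : Tm a b) :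
    (t.subst σ τ).eval M v V = t.eval M (fun i => (σ i).eval M v V) (fun i => V (τ i)) := by
  induction t with
  | var i => rfl
  | zero => rfl
  | one => rfl
  | add s t hs ht => simp only [Tm.subst, Tm.eval, hs, ht]
  | mul s t hs ht => simp only [Tm.subst, Tm.eval, hs, ht]
  | len Y => rfl

theorem Tm.subst_subst {a b a' b' a'' b'' : ℕ} (σ : Fin a → Tm a' b') (τ : Fin b → Fin b')
    (σ' : Fin a' → Tm a'' b'') (τ' : Fin b' → Fin b'') (t : Tm a b) :
    (t.subst σ τ).subst σ' τ' = t.subst (fun i => (σ i).subst σ' τ') (fun i => τ' (τ i)) := by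
  induction t with
  | var i => rfl
  | zero => rfl
  | one => rfl
  | add s t hs ht => simp only [Tm.subst, hs, ht]
  | mul s t hs ht => simp only [Tm.subst, hs, ht]
  | len Y => rfl

@[simp]
theorem Tm.eval_liftN (M : Struct.{u}) {a b : ℕ} (v : Fin a → M.Num) (d : M.Num)
    (V : Fin b → M.Sets) (t : Tm a b) :
    t.liftN.eval M (Fin.snoc (α := fun _ => M.Num) v d) V = t.eval M v V := by
  simp [Tm.liftN, Tm.eval_subst, Tm.eval]

@[simp]
theorem Tm.eval_liftS (M : Struct.{u}) {a b : ℕ} (v : Fin a → M.Num) (D : M.Sets)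
    (V : Fin b → M.Sets) (t : Tm a b) :
    t.liftS.eval M v (Fin.snoc (α := fun _ => M.Sets) V D) = t.eval M v V := by
  simp [Tm.liftS, Tm.eval_subst, Tm.eval]

/-- The substitution lemma: substituting and evaluating commute. -/
@[simp]
theorem Fml.holds_app (M : Struct.{u}) {a b a' b' : ℕ} (φ : Fml a b) (σ : Fin a → Tm a' b')
    (τ : Fin b → Fin b') (v : Fin a' → M.Num) (V : Fin b' → M.Sets) :
    (φ.app σ τ).Holds M v V ↔ φ.Holds M (fun i => (σ i).eval M v V) (fun i => V (τ i)) := by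
  have hN : ∀ {a b a' b' : ℕ} (σ : Fin a → Tm a' b') (v : Fin a' → M.Num)
      (V : Fin b' → M.Sets) (d : M.Num),
      (fun i => (Fin.snoc (α := fun _ => Tm (a' + 1) b') (fun i => (σ i).liftN)
        (.var (Fin.last _)) i).eval M (Fin.snoc (α := fun _ => M.Num) v d) V) =
        Fin.snoc (α := fun _ => M.Num) (fun i => (σ i).eval M v V) d := by
    intro a b a' b' σ v V d
    funext i
    refine Fin.lastCases ?_ (fun i => ?_) i <;> simp [Tm.eval]
  have hS : ∀ {b b' : ℕ} (τ : Fin b → Fin b') (V : Fin b' → M.Sets) (D : M.Sets),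
      (fun i => Fin.snoc (α := fun _ => M.Sets) V D
        (Fin.snoc (α := fun _ => Fin (b' + 1)) (fun i => (τ i).castSucc) (Fin.last _) i)) =
        Fin.snoc (α := fun _ => M.Sets) (fun i => V (τ i)) D := by
    intro b b' τ V D
    funext i
    refine Fin.lastCases ?_ (fun i => ?_) i <;> simp
  induction φ generalizing a' b' with
  | eqN s t => simp only [Fml.app, Fml.Holds, Tm.eval_subst]
  | eqS Y Z => rfl
  | le s t => simp only [Fml.app, Fml.Holds, Tm.eval_subst]
  | mem t Y => simp only [Fml.app, Fml.Holds, Tm.eval_subst]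
  | not φ ih => simp only [Fml.app, Fml.Holds, ih]
  | and φ ψ ih₁ ih₂ => simp only [Fml.app, Fml.Holds, ih₁, ih₂]
  | or φ ψ ih₁ ih₂ => simp only [Fml.app, Fml.Holds, ih₁, ih₂]
  | allN φ ih => simp only [Fml.app, Fml.Holds, ih, hN (b := 0)]
  | exN φ ih => simp only [Fml.app, Fml.Holds, ih, hN (b := 0)]
  | allS φ ih => simp only [Fml.app, Fml.Holds, ih, hS, Tm.eval_liftS]
  | exS φ ih => simp only [Fml.app, Fml.Holds, ih, hS, Tm.eval_liftS]

theorem Tm.subst_liftN {a b a' b' : ℕ} (σ : Fin a → Tm a' b') (τ : Fin b → Fin b') (t : Tm a b) :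
    t.liftN.subst (Fin.snoc (α := fun _ => Tm (a' + 1) b') (fun i => (σ i).liftN)
      (.var (Fin.last _))) τ = (t.subst σ τ).liftN := by
  simp [Tm.liftN, Tm.subst_subst, Tm.subst]

theorem IsSigma0B.app {a b a' b' : ℕ} {φ : Fml a b} (h : IsSigma0B φ) (σ : Fin a → Tm a' b')
    (τ : Fin b → Fin b') : IsSigma0B (φ.app σ τ) := by
  induction h generalizing a' b' with
  | eqN s t => exact .eqN _ _
  | eqS Y Z => exact .eqS _ _
  | le s t => exact .le _ _
  | mem t Y => exact .mem _ _
  | not _ ih => exact .not (ih σ τ)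
  | and _ _ ih₁ ih₂ => exact .and (ih₁ σ τ) (ih₂ σ τ)
  | or _ _ ih₁ ih₂ => exact .or (ih₁ σ τ) (ih₂ σ τ)
  | exB t _ ih =>
    have := IsSigma0B.exB (t.subst σ τ) (ih (Fin.snoc (α := fun _ => Tm (a' + 1) b')
      (fun i => (σ i).liftN) (.var (Fin.last _))) τ)
    simpa [Fml.exB, Fml.app, Tm.subst, Tm.subst_liftN] using this
  | allB t _ ih =>
    have := IsSigma0B.allB (t.subst σ τ) (ih (Fin.snoc (α := fun _ => Tm (a' + 1) b')
      (fun i => (σ i).liftN) (.var (Fin.last _))) τ)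
    simpa [Fml.allB, Fml.imp, Fml.app, Tm.subst, Tm.subst_liftN] using this

theorem IsSigma0B.lt {a b : ℕ} (s t : Tm a b) : IsSigma0B (Fml.lt s t) :=
  .and (.le _ _) (.not (.eqN _ _))

/-! ### A simp set for `Σ₀ᴮ`-formulas -/

attribute [simp] IsSigma0B.eqN IsSigma0B.eqS IsSigma0B.le IsSigma0B.mem IsSigma0B.lt IsSigma0B.app

@[simp]
theorem isSigma0B_not {a b : ℕ} {φ : Fml a b} : IsSigma0B (⌐φ) ↔ IsSigma0B φ :=
  ⟨fun h => by cases h; assumption, .not⟩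

@[simp]
theorem isSigma0B_and {a b : ℕ} {φ ψ : Fml a b} :
    IsSigma0B (φ ⋏ ψ) ↔ IsSigma0B φ ∧ IsSigma0B ψ :=
  ⟨fun h => by cases h; constructor <;> assumption, fun h => .and h.1 h.2⟩

@[simp]
theorem isSigma0B_or {a b : ℕ} {φ ψ : Fml a b} :
    IsSigma0B (φ ⋎ ψ) ↔ IsSigma0B φ ∧ IsSigma0B ψ :=
  ⟨fun h => by cases h; constructor <;> assumption, fun h => .or h.1 h.2⟩

@[simp]
theorem isSigma0B_imp {a b : ℕ} {φ ψ : Fml a b} :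
    IsSigma0B (φ ⇾ ψ) ↔ IsSigma0B φ ∧ IsSigma0B ψ := by
  simp [Fml.imp]

@[simp]
theorem isSigma0B_iff {a b : ℕ} {φ ψ : Fml a b} :
    IsSigma0B (φ ⇿ ψ) ↔ IsSigma0B φ ∧ IsSigma0B ψ := by
  simp only [Fml.iff, isSigma0B_and, isSigma0B_imp]; tauto

@[simp]
theorem isSigma0B_exB {a b : ℕ} {t : Tm a b} {φ : Fml (a + 1) b} :
    IsSigma0B (Fml.exB t φ) ↔ IsSigma0B φ := by
  refine ⟨fun h => ?_, .exB t⟩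
  generalize e : Fml.exB t φ = ψ at h
  cases h <;> simp_all [Fml.exB, Fml.allB]

@[simp]
theorem isSigma0B_allB {a b : ℕ} {t : Tm a b} {φ : Fml (a + 1) b} :
    IsSigma0B (Fml.allB t φ) ↔ IsSigma0B φ := by
  refine ⟨fun h => ?_, .allB t⟩
  generalize e : Fml.allB t φ = ψ at h
  cases h <;> simp_all [Fml.exB, Fml.allB, Fml.imp]

/-! ### Truth of the derived connectives -/

section Holds

variable (M : Struct.{u}) {a b : ℕ} (v : Fin a → M.Num) (V : Fin b → M.Sets)

@[simp]
theorem holds_imp (φ ψ : Fml a b) :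
    (φ.imp ψ).Holds M v V ↔ (φ.Holds M v V → ψ.Holds M v V) := by
  simp only [Fml.imp, Fml.Holds]; tauto

@[simp]
theorem holds_iff (φ ψ : Fml a b) :
    (φ.iff ψ).Holds M v V ↔ (φ.Holds M v V ↔ ψ.Holds M v V) := by
  simp only [Fml.iff, Fml.Holds, holds_imp]; tauto

@[simp]
theorem holds_exB (t : Tm a b) (φ : Fml (a + 1) b) :
    (Fml.exB t φ).Holds M v V ↔ ∃ d, M.le d (t.eval M v V) ∧
      φ.Holds M (Fin.snoc (α := fun _ => M.Num) v d) V := by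
  simp [Fml.exB, Fml.Holds, Tm.eval]

@[simp]
theorem holds_allB (t : Tm a b) (φ : Fml (a + 1) b) :
    (Fml.allB t φ).Holds M v V ↔ ∀ d, M.le d (t.eval M v V) →
      φ.Holds M (Fin.snoc (α := fun _ => M.Num) v d) V := by
  simp [Fml.allB, Fml.Holds, Tm.eval]

@[simp]
theorem holds_eqN (s t : Tm a b) :
    (s ≐ t).Holds M v V ↔ s.eval M v V = t.eval M v V := Iff.rfl

@[simp]
theorem holds_eqS (Y Z : Fin b) : (Fml.eqS (a := a) Y Z).Holds M v V ↔ V Y = V Z := Iff.rfl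

@[simp]
theorem holds_le (s t : Tm a b) :
    (s ⩽ t).Holds M v V ↔ M.le (s.eval M v V) (t.eval M v V) := Iff.rfl

@[simp]
theorem holds_mem (t : Tm a b) (Y : Fin b) :
    (Fml.mem t Y).Holds M v V ↔ M.mem (t.eval M v V) (V Y) := Iff.rfl

@[simp]
theorem holds_not (φ : Fml a b) : (⌐φ).Holds M v V ↔ ¬ φ.Holds M v V := Iff.rfl

@[simp]
theorem holds_and (φ ψ : Fml a b) :
    (φ ⋏ ψ).Holds M v V ↔ φ.Holds M v V ∧ ψ.Holds M v V := Iff.rfl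

@[simp]
theorem holds_or (φ ψ : Fml a b) :
    (φ ⋎ ψ).Holds M v V ↔ φ.Holds M v V ∨ ψ.Holds M v V := Iff.rfl

@[simp]
theorem holds_allN (φ : Fml (a + 1) b) :
    (Fml.allN φ).Holds M v V ↔ ∀ d, φ.Holds M (Fin.snoc (α := fun _ => M.Num) v d) V := Iff.rfl

@[simp]
theorem holds_exN (φ : Fml (a + 1) b) :
    (Fml.exN φ).Holds M v V ↔ ∃ d, φ.Holds M (Fin.snoc (α := fun _ => M.Num) v d) V := Iff.rfl

@[simp]
theorem holds_allS (φ : Fml a (b + 1)) :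
    (Fml.allS φ).Holds M v V ↔ ∀ D, φ.Holds M v (Fin.snoc (α := fun _ => M.Sets) V D) := Iff.rfl

@[simp]
theorem holds_exS (φ : Fml a (b + 1)) :
    (Fml.exS φ).Holds M v V ↔ ∃ D, φ.Holds M v (Fin.snoc (α := fun _ => M.Sets) V D) := Iff.rfl

@[simp]
theorem snoc_mk_lt {α : Type u} {n i : ℕ} (w : Fin n → α) (d : α) (h : i < n + 1) (h' : i < n) :
    Fin.snoc (α := fun _ => α) w d ⟨i, h⟩ = w ⟨i, h'⟩ := by
  simp [Fin.snoc, h', Fin.castLT]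

@[simp]
theorem snoc_mk_eq {α : Type u} {n i : ℕ} (w : Fin n → α) (d : α) (h : i < n + 1) (h' : i = n) :
    Fin.snoc (α := fun _ => α) w d ⟨i, h⟩ = d := by
  simp [Fin.snoc, h']

end Holds

/-! ### Terms in a model -/

section Eval

variable {M : Struct.{u}}

instance : Zero M.Num := ⟨M.zero⟩
instance : One M.Num := ⟨M.one⟩
instance : Add M.Num := ⟨M.add⟩
instance : Mul M.Num := ⟨M.mul⟩
instance : LE M.Num := ⟨M.le⟩
instance : Membership M.Num M.Sets := ⟨fun Y z => M.mem z Y⟩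

variable {a b : ℕ} (v : Fin a → M.Num) (V : Fin b → M.Sets)

@[simp] theorem eval_var (i : Fin a) : (Tm.var i).eval M v V = v i := rfl
@[simp] theorem eval_zero : (0 : Tm a b).eval M v V = 0 := rfl
@[simp] theorem eval_one : (1 : Tm a b).eval M v V = 1 := rfl
@[simp] theorem eval_add (s t : Tm a b) :
    (s + t).eval M v V = s.eval M v V + t.eval M v V := rfl
@[simp] theorem eval_mul (s t : Tm a b) :
    (s * t).eval M v V = s.eval M v V * t.eval M v V := rfl
@[simp] theorem eval_len (Y : Fin b) : (Tm.len Y : Tm a b).eval M v V = M.len (V Y) := rfl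
@[simp] theorem le_eq (s t : M.Num) : M.le s t ↔ s ≤ t := Iff.rfl
@[simp] theorem mem_eq (s : M.Num) (Y : M.Sets) : M.mem s Y ↔ s ∈ Y := Iff.rfl

@[simp]
theorem holds_lt (s t : Tm a b) :
    (Fml.lt s t).Holds M v V ↔ s.eval M v V ≤ t.eval M v V ∧ s.eval M v V ≠ t.eval M v V := Iff.rfl

end Eval

/-! ### Comprehension and induction -/

section Definable

variable {M : Struct.{u}}

/-- `P` is defined by a `Σ₀ᴮ`-formula with parameters. -/
def Definable (P : M.Num → Prop) : Prop :=
  ∃ (a b : ℕ) (φ : Fml (a + 1) b) (v : Fin a → M.Num) (V : Fin b → M.Sets), IsSigma0B φ ∧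
    ∀ z, P z ↔ φ.Holds M (Fin.snoc (α := fun _ => M.Num) v z) V

theorem Definable.forall_le {P : M.Num → Prop} (h : Definable P) :
    Definable fun z => ∀ w, w ≤ z → P w := by
  obtain ⟨a, b, φ, v, V, hφ, e⟩ := h
  let σ : Fin (a + 1) → Tm (a + 2) b :=
    Fin.snoc (α := fun _ => Tm (a + 2) b) (fun i => .var i.castSucc.castSucc) (.var (Fin.last _))
  refine ⟨a, b, Fml.allB (.var (Fin.last _)) (φ.app σ id), v, V, .allB _ (hφ.app _ _), fun z => ?_⟩
  have e' : ∀ w, (fun i => (σ i).eval M (Fin.snoc (α := fun _ => M.Num)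
      (Fin.snoc (α := fun _ => M.Num) v z) w) V) = Fin.snoc (α := fun _ => M.Num) v w := by
    intro z
    funext i
    refine Fin.lastCases ?_ (fun i => ?_) i <;> simp [σ]
  simp [e, e']

end Definable

/-- `M` is a model of `V⁰`. -/
class V0Model (M : Struct.{u}) : Prop where
  isModel : M.IsModel V0

section Model

variable (M : Struct.{u}) [hM : V0Model M]

theorem V0Model.basic {a b : ℕ} {φ : Fml a b} (h : IsTwoBasic φ) (v : Fin a → M.Num)
    (V : Fin b → M.Sets) : φ.Holds M v V := hM.isModel a b φ (Or.inl h) v V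

variable {M}

/-- Comprehension with the bounding variable and the comprehended variable kept apart. -/
theorem exists_set {a b : ℕ} {φ : Fml (a + 1) b} (hφ : IsSigma0B φ) (v : Fin a → M.Num)
    (V : Fin b → M.Sets) (y : M.Num) :
    ∃ Y : M.Sets, M.len Y ≤ y ∧
      ∀ z, z ≤ y → z ≠ y → (z ∈ Y ↔ φ.Holds M (Fin.snoc (α := fun _ => M.Num) v z) V) := by
  let σ : Fin (a + 1) → Tm (a + 2) b :=
    Fin.snoc (α := fun _ => Tm (a + 2) b) (fun i => .var i.castSucc.castSucc) (.var (Fin.last _))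
  have h := hM.isModel _ _ _ (Or.inr (.mk (φ.app σ id) (hφ.app _ _)))
    (Fin.snoc (α := fun _ => M.Num) v y) V
  have e : ∀ z, (fun i => (σ i).eval M (Fin.snoc (α := fun _ => M.Num)
      (Fin.snoc (α := fun _ => M.Num) v y) z) V) = Fin.snoc (α := fun _ => M.Num) v z := by
    intro z
    funext i
    refine Fin.lastCases ?_ (fun i => ?_) i <;> simp [σ]
  obtain ⟨Y, h₁, h₂⟩ := h
  refine ⟨Y, ?_, fun z hz hz' => ?_⟩
  · simpa [snoc_mk_eq] using h₁
  · have := h₂ z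
    simp [snoc_mk_eq, snoc_mk_lt, Fml.lt, e, hz, hz'] at this
    exact this

theorem B1 (x : M.Num) : x + 1 ≠ 0 := V0Model.basic M .B1 ![x] ![]
theorem B2 {x y : M.Num} : x + 1 = y + 1 → x = y :=
  (holds_imp M _ _ _ _).1 (V0Model.basic M .B2 ![x, y] ![])
theorem B3 (x : M.Num) : x + 0 = x := V0Model.basic M .B3 ![x] ![]
theorem B4 (x y : M.Num) : x + (y + 1) = x + y + 1 := V0Model.basic M .B4 ![x, y] ![]
theorem B5 (x : M.Num) : x * 0 = 0 := V0Model.basic M .B5 ![x] ![]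
theorem B6 (x y : M.Num) : x * (y + 1) = x * y + x := V0Model.basic M .B6 ![x, y] ![]
theorem B7 {x y : M.Num} (h₁ : x ≤ y) (h₂ : y ≤ x) : x = y :=
  (holds_imp M _ _ _ _).1 (V0Model.basic M .B7 ![x, y] ![]) ⟨h₁, h₂⟩
theorem B8 (x y : M.Num) : x ≤ x + y := V0Model.basic M .B8 ![x, y] ![]
theorem B9 (x : M.Num) : 0 ≤ x := V0Model.basic M .B9 ![x] ![]
theorem B10 (x y : M.Num) : x ≤ y ∨ y ≤ x := V0Model.basic M .B10 ![x, y] ![]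
theorem B11 {x y : M.Num} : x ≤ y ↔ x ≤ y + 1 ∧ x ≠ y + 1 :=
  (holds_iff M _ _ _ _).1 (V0Model.basic M .B11 ![x, y] ![])
theorem B12 {x : M.Num} (h : x ≠ 0) : ∃ y, y + 1 = x := by
  have := (holds_imp M _ _ _ _).1 (V0Model.basic M .B12 ![x] ![]) h
  obtain ⟨y, -, hy⟩ := (holds_exB M _ _ _ _).1 this
  exact ⟨y, hy⟩
theorem L1 {x : M.Num} {Y : M.Sets} : x ∈ Y → x ≤ M.len Y ∧ x ≠ M.len Y :=
  (holds_imp M _ _ _ _).1 (V0Model.basic M .L1 ![x] ![Y])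
theorem L2 {x : M.Num} {Y : M.Sets} : x + 1 = M.len Y → x ∈ Y :=
  (holds_imp M _ _ _ _).1 (V0Model.basic M .L2 ![x] ![Y])

/-- Comprehension, for definable properties. -/
theorem Definable.exists_set {P : M.Num → Prop} (h : Definable P) (y : M.Num) :
    ∃ Y : M.Sets, M.len Y ≤ y ∧ ∀ z, z ≤ y → z ≠ y → (z ∈ Y ↔ P z) := by
  obtain ⟨a, b, φ, v, V, hφ, e⟩ := h
  simp only [e]
  exact TwoSorted.exists_set hφ v V y

/-- Induction for definable properties. The set of all `z < y` such that `P` holds up to `z`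
has a length; by `L1` and `L2`, the length can only be `y`. -/
theorem Definable.induction {P : M.Num → Prop} (h : Definable P) (h0 : P 0)
    (hs : ∀ z, P z → P (z + 1)) (y : M.Num) : P y := by
  by_cases hy : y = 0
  · exact hy ▸ h0
  obtain ⟨Y, hYy, hY⟩ := h.forall_le.exists_set y
  have h0Y : (0 : M.Num) ∈ Y := (hY 0 (B9 y) (Ne.symm hy)).2 fun w hw => B7 hw (B9 w) ▸ h0
  obtain ⟨t, ht⟩ := B12 (x := M.len Y) fun e => (L1 h0Y).2 e.symm
  have htY : t ∈ Y := L2 ht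
  have hty : t ≤ y ∧ t ≠ y := by
    by_cases e : M.len Y = y
    · exact e ▸ L1 htY
    -- The order is not yet known to be transitive: `t < y` comes from `B7`, `B10` and `B11`.
    · have key : ¬ y ≤ t := fun hyt => e (B7 hYy (ht ▸ (B11.1 hyt).1))
      exact ⟨(B10 t y).resolve_right key, fun e => key (e ▸ (B10 t t).elim id id)⟩
  -- As `P` holds up to `t`, it holds up to `t + 1 = |Y|`; if this were below `y`, then `|Y| ∈ Y`.
  have ih := (hY t hty.1 hty.2).1 htY
  have ih' : ∀ w, w ≤ t + 1 → P w := by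
    intro w hw
    by_cases e : w = t + 1
    · exact e ▸ hs t (ih t ((B10 t t).elim id id))
    · exact ih w (B11.2 ⟨hw, e⟩)
  by_cases e : M.len Y = y
  · exact e ▸ ht ▸ ih' _ ((B10 (t + 1) (t + 1)).elim id id)
  · exact absurd rfl (L1 ((hY _ hYy e).2 (ht ▸ ih'))).2

end Model

/-! ### Arithmetic in a model -/

section Arith

variable {M : Struct.{u}} [V0Model M]

theorem num_zero_add (q : M.Num) : 0 + q = q := by
  refine Definable.induction (P := fun q : M.Num => 0 + q = q)
    ⟨0, 0, 0 + x 0 ≐ x 0, ![], ![], by simp, fun z => by simp⟩ (B3 0)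
    (fun z hz => ?_) q
  rw [B4, hz]

theorem num_succ_add (p q : M.Num) : p + 1 + q = p + q + 1 := by
  refine Definable.induction (P := fun q : M.Num => p + 1 + q = p + q + 1)
    ⟨1, 0, x 0 + 1 + x 1 ≐ x 0 + x 1 + 1, ![p], ![],
      by simp, fun z => by simp⟩ (by rw [B3, B3])
    (fun z hz => ?_) q
  rw [B4, hz, B4]

theorem num_add_comm (p q : M.Num) : p + q = q + p := by
  refine Definable.induction (P := fun q : M.Num => p + q = q + p)
    ⟨1, 0, x 0 + x 1 ≐ x 1 + x 0, ![p], ![],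
      by simp, fun z => by simp⟩ (by rw [B3, num_zero_add])
    (fun z hz => ?_) q
  rw [B4, hz, num_succ_add]

theorem num_add_assoc (p q r : M.Num) : p + q + r = p + (q + r) := by
  refine Definable.induction (P := fun r : M.Num => p + q + r = p + (q + r))
    ⟨2, 0, x 0 + x 1 + x 2 ≐ x 0 + (x 1 + x 2), ![p, q], ![],
      by simp, fun z => by simp⟩ (by rw [B3, B3])
    (fun z hz => ?_) r
  rw [B4, B4, B4, hz]

theorem num_zero_mul (q : M.Num) : 0 * q = 0 := by
  refine Definable.induction (P := fun q : M.Num => 0 * q = 0)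
    ⟨0, 0, 0 * x 0 ≐ 0, ![], ![], by simp, fun z => by simp⟩ (B5 0)
    (fun z hz => ?_) q
  rw [B6, hz, B3]

theorem num_mul_add (p q r : M.Num) : p * (q + r) = p * q + p * r := by
  refine Definable.induction (P := fun r : M.Num => p * (q + r) = p * q + p * r)
    ⟨2, 0, x 0 * (x 1 + x 2) ≐ x 0 * x 1 + x 0 * x 2, ![p, q], ![],
      by simp, fun z => by simp⟩ (by rw [B3, B5, B3])
    (fun z hz => ?_) r
  rw [B4, B6, B6, hz, num_add_assoc]

theorem num_succ_mul (p q : M.Num) : (p + 1) * q = p * q + q := by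
  refine Definable.induction (P := fun q : M.Num => (p + 1) * q = p * q + q)
    ⟨1, 0, (x 0 + 1) * x 1 ≐ x 0 * x 1 + x 1, ![p], ![],
      by simp, fun z => by simp⟩ (by rw [B5, B5, B3])
    (fun z hz => ?_) q
  rw [B6, B6, hz, B4, B4, num_add_assoc (p * z), num_add_comm z p, ← num_add_assoc (p * z)]

theorem num_mul_comm (p q : M.Num) : p * q = q * p := by
  refine Definable.induction (P := fun q : M.Num => p * q = q * p)
    ⟨1, 0, x 0 * x 1 ≐ x 1 * x 0, ![p], ![],
      by simp, fun z => by simp⟩ (by rw [B5, num_zero_mul])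
    (fun z hz => ?_) q
  rw [B6, num_succ_mul, hz]

theorem num_mul_assoc (p q r : M.Num) : p * q * r = p * (q * r) := by
  refine Definable.induction (P := fun r : M.Num => p * q * r = p * (q * r))
    ⟨2, 0, x 0 * x 1 * x 2 ≐ x 0 * (x 1 * x 2), ![p, q], ![],
      by simp, fun z => by simp⟩ (by rw [B5, B5, B5])
    (fun z hz => ?_) r
  rw [B6, B6, hz, num_mul_add]

theorem num_mul_one (p : M.Num) : p * 1 = p := by
  have := B6 p 0
  rwa [num_zero_add, B5, num_zero_add] at this

theorem num_add_right_cancel {p q r : M.Num} (h : p + r = q + r) : p = q := by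
  refine Definable.induction (P := fun r : M.Num => p + r = q + r → p = q)
    ⟨2, 0, x 0 + x 2 ≐ x 1 + x 2 ⇾ x 0 ≐ x 1, ![p, q], ![],
      by simp, fun z => by simp⟩ (by rw [B3, B3]; exact id)
    (fun z hz h => hz ?_) r h
  rw [B4, B4] at h
  exact B2 h

theorem num_le_refl (p : M.Num) : p ≤ p := (B10 p p).elim id id

/-- The order is the one given by addition. Transitivity and monotonicity, which are not among the
axioms, follow from this. -/
theorem num_exists_add {p q : M.Num} (h : p ≤ q) : ∃ r, q = p + r := by
  have : p ≤ q → ∃ r, r ≤ q ∧ q = p + r := by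
    refine Definable.induction (P := fun q : M.Num => p ≤ q → ∃ r, r ≤ q ∧ q = p + r)
      ⟨1, 0, x 0 ⩽ x 1 ⇾ .exB (x 1) (x 1 ≐ x 0 + x 2), ![p], ![],
        by simp, fun z => by simp⟩ (fun h => ⟨0, num_le_refl 0, ?_⟩)
      (fun z hz h => ?_) q
    · rw [B3, B7 h (B9 p)]
    · by_cases e : p = z + 1
      · exact ⟨0, B9 _, by rw [B3, e]⟩
      · obtain ⟨r, -, hr⟩ := hz (B11.2 ⟨h, e⟩)
        have e' : z + 1 = p + (r + 1) := by rw [hr, B4]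
        have hr' : r + 1 ≤ p + (r + 1) := num_add_comm (r + 1) p ▸ B8 (r + 1) p
        exact ⟨r + 1, e'.symm ▸ hr', e'⟩
  obtain ⟨r, -, hr⟩ := this h
  exact ⟨r, hr⟩

instance : CommSemiring M.Num where
  add_assoc := num_add_assoc
  zero_add := num_zero_add
  add_zero := B3
  add_comm := num_add_comm
  mul_assoc := num_mul_assoc
  one_mul p := by rw [num_mul_comm, num_mul_one]
  mul_one := num_mul_one
  left_distrib := num_mul_add
  right_distrib p q r := by rw [num_mul_comm, num_mul_add, num_mul_comm r, num_mul_comm r]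
  zero_mul := num_zero_mul
  mul_zero := B5
  mul_comm := num_mul_comm
  nsmul := nsmulRec

instance : IsCancelAdd M.Num where
  add_right_cancel _ _ _ h := num_add_right_cancel h
  add_left_cancel p q r h := num_add_right_cancel (r := p) (by rwa [add_comm q, add_comm r])

open Classical in
noncomputable instance : LinearOrder M.Num where
  le_refl := num_le_refl
  le_trans p q r h₁ h₂ := by
    obtain ⟨s, rfl⟩ := num_exists_add h₁
    obtain ⟨t, rfl⟩ := num_exists_add h₂
    rw [add_assoc]; exact B8 _ _
  le_antisymm _ _ := B7
  le_total := B10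
  toDecidableLE := inferInstance

instance : CanonicallyOrderedAdd M.Num where
  exists_add_of_le := num_exists_add
  le_self_add := B8
  le_add_self p q := by rw [add_comm]; exact B8 p q

instance : IsOrderedCancelAddMonoid M.Num where
  add_le_add_left p q h r := by
    obtain ⟨s, rfl⟩ := num_exists_add h
    rw [add_right_comm]; exact B8 _ _
  le_of_add_le_add_left p q r h := by
    obtain ⟨s, hs⟩ := num_exists_add h
    rw [add_assoc] at hs
    rw [add_left_cancel hs]; exact B8 _ _

theorem num_eq_zero_or_succ (p : M.Num) : p = 0 ∨ ∃ q, p = q + 1 := by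
  by_cases h : p = 0
  · exact Or.inl h
  · obtain ⟨q, hq⟩ := B12 h
    exact Or.inr ⟨q, hq.symm⟩

instance : Nontrivial M.Num := ⟨0, 1, fun h => B1 (0 : M.Num) (by rw [zero_add, h])⟩

theorem num_lt_succ_iff {p q : M.Num} : p < q + 1 ↔ p ≤ q := by
  rw [B11, lt_iff_le_and_ne]

noncomputable instance : SuccOrder M.Num :=
  SuccOrder.ofSuccLeIff (fun p => p + 1) fun {p q} => by
    rw [← not_lt, num_lt_succ_iff, not_le]

noncomputable instance : SuccAddOrder M.Num where
  succ_eq_add_one _ := rfl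

instance : NoZeroDivisors M.Num where
  eq_zero_or_eq_zero_of_mul_eq_zero {p q} h := by
    rcases num_eq_zero_or_succ q with rfl | ⟨r, rfl⟩
    · exact Or.inr rfl
    · rw [mul_add, mul_one] at h
      exact Or.inl (add_eq_zero.1 h).2

instance : IsStrictOrderedRing M.Num where
  zero_le_one := B9 1
  mul_lt_mul_of_pos_left p hp q r h := by
    obtain ⟨s, rfl⟩ := num_exists_add h.le
    have hs : s ≠ 0 := by rintro rfl; simp at h
    rw [mul_add]
    exact lt_add_of_pos_right _ (pos_iff_ne_zero.2 (mul_ne_zero hp.ne' hs))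
  mul_lt_mul_of_pos_right p hp q r h := by
    obtain ⟨s, rfl⟩ := num_exists_add h.le
    have hs : s ≠ 0 := by rintro rfl; simp at h
    rw [add_mul]
    exact lt_add_of_pos_right _ (pos_iff_ne_zero.2 (mul_ne_zero hs hp.ne'))

/-- The bound on `h` makes the property `Σ₀ᴮ`. -/
theorem num_even_or_odd (p : M.Num) : ∃ h, h ≤ p ∧ (p = h + h ∨ p = h + h + 1) := by
  refine Definable.induction (P := fun p : M.Num => ∃ h, h ≤ p ∧ (p = h + h ∨ p = h + h + 1))
    ⟨0, 0, .exB (x 0) (x 0 ≐ x 1 + x 1 ⋎ x 0 ≐ x 1 + x 1 + 1), ![], ![], by simp,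
      fun z => by simp⟩ ⟨0, le_rfl, by simp⟩ (fun z => ?_) p
  rintro ⟨h, hz, rfl | rfl⟩
  · exact ⟨h, by rw [add_assoc]; exact le_self_add, by simp⟩
  · exact ⟨h + 1, le_iff_exists_add.2 ⟨h + 1, by ring⟩, Or.inl (by ring)⟩

/-! ### The pairing function -/

theorem exists_pair (p q : M.Num) : ∃ z, (p + q) * (p + q + 1) + (p + p) = z + z := by
  obtain ⟨h, -, e | e⟩ := num_even_or_odd (p + q)
  · exact ⟨h * (p + q + 1) + p, by rw [e]; ring⟩
  · exact ⟨(p + q) * (h + 1) + p, by rw [e]; ring⟩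

/-- The pairing function `⟨p, q⟩`. -/
noncomputable def pr (p q : M.Num) : M.Num := (exists_pair p q).choose

theorem pr_spec (p q : M.Num) : (p + q) * (p + q + 1) + (p + p) = pr p q + pr p q :=
  (exists_pair p q).choose_spec

theorem pr_eq_iff {p q z : M.Num} : (p + q) * (p + q + 1) + (p + p) = z + z ↔ pr p q = z := by
  constructor
  · intro h
    rw [pr_spec] at h
    grind
  · rintro rfl
    exact pr_spec p q

/-- Pairs with the same code have the same sum: from `p' + q' < p + q` it would follow that
twice the first code exceeds twice the second one by at least `2`. -/
theorem pr_inj_sum {p q p' q' : M.Num} (h : pr p q = pr p' q') : p + q ≤ p' + q' := by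
  have h₁ := pr_spec p q
  have h₂ := pr_spec p' q'
  rw [h, ← h₂] at h₁
  by_contra! hlt
  obtain ⟨r, hr⟩ := num_exists_add (Order.add_one_le_of_lt hlt)
  rw [hr] at h₁
  have : (p' + q') * (p' + q' + 1) + (p' + p') +
      (q' + q' + r * r + 3 * r + 2 * ((p' + q') * r) + 2 * p + 1 + 1) =
      (p' + q') * (p' + q' + 1) + (p' + p') := by
    refine Eq.trans ?_ h₁
    ring
  exact B1 _ (add_eq_left.1 this)

@[simp]
theorem pr_inj {p q p' q' : M.Num} : pr p q = pr p' q' ↔ p = p' ∧ q = q' := by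
  refine ⟨fun h => ?_, by rintro ⟨rfl, rfl⟩; rfl⟩
  have e : p + q = p' + q' := (pr_inj_sum h).antisymm (pr_inj_sum h.symm)
  have h₁ := pr_spec p q
  have h₂ := pr_spec p' q'
  rw [h, ← h₂, e] at h₁
  have h₃ := add_left_cancel h₁
  have : p = p' := by grind
  exact ⟨this, by subst this; exact add_left_cancel e⟩

theorem pr_mono {p q p' q' : M.Num} (hp : p ≤ p') (hq : q ≤ q') : pr p q ≤ pr p' q' := by
  have h : pr p q + pr p q ≤ pr p' q' + pr p' q' := by
    rw [← pr_spec, ← pr_spec]; gcongr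
  grind

theorem le_pr_left (p q : M.Num) : p ≤ pr p q := by
  have h : p + p ≤ pr p q + pr p q := by
    rw [← pr_spec]; exact le_add_self
  grind

theorem le_pr_right (p q : M.Num) : q ≤ pr p q := by
  have h : q + q ≤ pr p q + pr p q := by
    rw [← pr_spec]
    rcases num_eq_zero_or_succ q with rfl | ⟨r, rfl⟩
    · simp
    · refine le_iff_exists_add.2 ⟨p * p + 2 * p * r + 5 * p + r * r + r, ?_⟩
      ring
  grind

/-- The code of a triple. -/
noncomputable def tri (p q r : M.Num) : M.Num := pr p (pr q r)

/-- The code of a sextuple. -/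
noncomputable def six (p q r s t w : M.Num) : M.Num := pr p (pr q (pr r (pr s (pr t w))))

/-- The code of the state whose components have the codes `i, j, f, a, d, c, l`. -/
noncomputable def tup (i j f a d c l : M.Num) : M.Num := pr (pr i j) (pr f (pr a (pr d (pr c l))))

@[simp]
theorem tri_inj {p q r p' q' r' : M.Num} : tri p q r = tri p' q' r' ↔ p = p' ∧ q = q' ∧ r = r' := by
  simp [tri]

@[simp]
theorem tup_inj {i j f a d c l i' j' f' a' d' c' l' : M.Num} :
    tup i j f a d c l = tup i' j' f' a' d' c' l' ↔
      i = i' ∧ j = j' ∧ f = f' ∧ a = a' ∧ d = d' ∧ c = c' ∧ l = l' := by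
  simp [tup, and_assoc]

end Arith

/-! ### Truth of the coding formulas -/

section Coding

-- The indices of variables keep the form `⟨k, _⟩` during evaluation, so that `snoc_mk_lt` and
-- `snoc_mk_eq` apply to them; `1 + 1 ≤ i` is not turned into `1 < i`.
attribute [-simp] Fin.zero_eta Fin.mk_one Fin.mk_zero Order.add_one_le_iff

variable {M : Struct.{u}}

section

variable {a b : ℕ} (v : Fin a → M.Num) (V : Fin b → M.Sets)

@[simp] theorem eval_val (t : Tm a b) : (val t).eval M v V = t.eval M v V + 1 := rfl
@[simp] theorem eval_box : (box : Tm a b).eval M v V = 0 := rfl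
@[simp] theorem eval_minusOne : (minusOne : Tm a b).eval M v V = 1 + 1 := rfl

@[simp]
theorem holds_between (s t r : Tm a b) :
    (between s t r).Holds M v V ↔ s.eval M v V ≤ t.eval M v V ∧ t.eval M v V ≤ r.eval M v V :=
  Iff.rfl

@[simp]
theorem holds_isBit (t : Tm a b) :
    (isBit t).Holds M v V ↔ t.eval M v V = 0 + 1 ∨ t.eval M v V = 1 + 1 := Iff.rfl

@[simp] theorem isSigma0B_between (s t r : Tm a b) : IsSigma0B (between s t r) := by
  simp [between]
@[simp] theorem isSigma0B_isBit (t : Tm a b) : IsSigma0B (isBit t) := by simp [isBit]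

end

variable [V0Model M]

@[simp]
theorem holds_pair (v : Fin 3 → M.Num) (V : Fin 0 → M.Sets) :
    pair.Holds M v V ↔ pr (v 0) (v 1) = v 2 := pr_eq_iff

theorem le_of_tri_eq {p q r z : M.Num} (h : tri p q r = z) :
    p ≤ z ∧ q ≤ z ∧ r ≤ z ∧ pr q r ≤ z := by
  subst h
  have h₁ := le_pr_right p (pr q r)
  exact ⟨le_pr_left _ _, (le_pr_left _ _).trans h₁, (le_pr_right _ _).trans h₁, h₁⟩

theorem le_of_six_eq {p q r s t w z : M.Num} (h : six p q r s t w = z) :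
    (p ≤ z ∧ q ≤ z ∧ r ≤ z ∧ s ≤ z ∧ t ≤ z ∧ w ≤ z) ∧
      pr q (pr r (pr s (pr t w))) ≤ z ∧ pr r (pr s (pr t w)) ≤ z ∧ pr s (pr t w) ≤ z ∧
      pr t w ≤ z := by
  subst h
  have h₁ := le_pr_right p (pr q (pr r (pr s (pr t w))))
  have h₂ := (le_pr_right q (pr r (pr s (pr t w)))).trans h₁
  have h₃ := (le_pr_right r (pr s (pr t w))).trans h₂
  have h₄ := (le_pr_right s (pr t w)).trans h₃
  exact ⟨⟨le_pr_left _ _, (le_pr_left _ _).trans h₁, (le_pr_left _ _).trans h₂,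
    (le_pr_left _ _).trans h₃, (le_pr_left _ _).trans h₄, (le_pr_right _ _).trans h₄⟩,
    h₁, h₂, h₃, h₄⟩

theorem le_of_tup_eq {i j f a d c l z : M.Num} (h : tup i j f a d c l = z) :
    (i ≤ z ∧ j ≤ z ∧ f ≤ z ∧ a ≤ z ∧ d ≤ z ∧ c ≤ z ∧ l ≤ z) ∧ pr i j ≤ z ∧
      pr f (pr a (pr d (pr c l))) ≤ z ∧ pr a (pr d (pr c l)) ≤ z ∧ pr d (pr c l) ≤ z ∧
      pr c l ≤ z := by
  obtain ⟨⟨h₁, h₂, h₃, h₄, h₅, h₆⟩, h₇⟩ := le_of_six_eq (show six (pr i j) f a d c l = z from h)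
  exact ⟨⟨(le_pr_left _ _).trans h₁, (le_pr_right _ _).trans h₁, h₂, h₃, h₄, h₅, h₆⟩, h₁, h₇⟩

@[simp]
theorem holds_triple (v : Fin 4 → M.Num) (V : Fin 0 → M.Sets) :
    triple.Holds M v V ↔ tri (v 0) (v 1) (v 2) = v 3 := by
  simp only [triple, holds_exB]
  simp [-Fin.reduceFinMk]
  exact and_iff_right_of_imp fun h => (le_of_tri_eq h).2.2.2

@[simp]
theorem holds_sextuple (v : Fin 7 → M.Num) (V : Fin 0 → M.Sets) :
    sextuple.Holds M v V ↔ six (v 0) (v 1) (v 2) (v 3) (v 4) (v 5) = v 6 := by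
  simp [sextuple, -Fin.reduceFinMk]
  constructor
  · rintro ⟨-, -, -, -, h⟩
    exact h
  · intro h
    obtain ⟨-, h₁, h₂, h₃, h₄⟩ := le_of_six_eq h
    exact ⟨h₄, h₃, h₂, h₁, h⟩

@[simp]
theorem holds_tuple (v : Fin 8 → M.Num) (V : Fin 0 → M.Sets) :
    tuple.Holds M v V ↔ tup (v 0) (v 1) (v 2) (v 3) (v 4) (v 5) (v 6) = v 7 := by
  simp [tuple, -Fin.reduceFinMk]
  constructor
  · rintro ⟨-, -, -, -, -, h⟩
    exact h
  · intro h
    obtain ⟨-, h₁, h₂, h₃, h₄, h₅⟩ := le_of_tup_eq h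
    exact ⟨h₁, h₅, h₄, h₃, h₂, h⟩

@[simp]
theorem holds_inRel2 (v : Fin 2 → M.Num) (V : Fin 1 → M.Sets) :
    inRel2.Holds M v V ↔ pr (v 0) (v 1) ∈ V 0 := by
  simp [inRel2, -Fin.reduceFinMk]
  exact and_iff_right_of_imp fun h => (L1 h).1

@[simp]
theorem holds_inRel3 (v : Fin 3 → M.Num) (V : Fin 1 → M.Sets) :
    inRel3.Holds M v V ↔ tri (v 0) (v 1) (v 2) ∈ V 0 := by
  simp [inRel3, -Fin.reduceFinMk]
  exact and_iff_right_of_imp fun h => (L1 h).1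

@[simp] theorem isSigma0B_pair : IsSigma0B pair := by simp [pair]
@[simp] theorem isSigma0B_triple : IsSigma0B triple := by simp [triple]
@[simp] theorem isSigma0B_sextuple : IsSigma0B sextuple := by simp [sextuple]
@[simp] theorem isSigma0B_tuple : IsSigma0B tuple := by simp [tuple]
@[simp] theorem isSigma0B_inRel2 : IsSigma0B inRel2 := by simp [inRel2]
@[simp] theorem isSigma0B_inRel3 : IsSigma0B inRel3 := by simp [inRel3]

/-! ### Truth of the formulas about states -/

/-- The quiescent state. -/
noncomputable def qState : M.Num := tup 0 0 0 0 0 0 0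

/-- `coord(s) = (i, j)`. -/
def CoordIs (i j s : M.Num) : Prop := ∃ f a d c l, tup (i + 1) (j + 1) f a d c l = s
/-- The component `flag(s)` has the code `p`. -/
def FlagIs (p s : M.Num) : Prop := ∃ i j a d c l, tup i j p a d c l = s
/-- The component `a(s)` has the code `p`. -/
def AIs (p s : M.Num) : Prop := ∃ i j f d c l, tup i j f p d c l = s
/-- The component `pd(s)` has the code `p`. -/
def PdIs (p s : M.Num) : Prop := ∃ i j f a c l, tup i j f a p c l = s
/-- The component `pc(s)` has the code `p`. -/
def PcIs (p s : M.Num) : Prop := ∃ i j f a d l, tup i j f a d p l = s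
/-- The component `label(s)` has the code `p`. -/
def LabelIs (p s : M.Num) : Prop := ∃ i j f a d c, tup i j f a d c p = s

section

variable {i j f a d c l p q : M.Num}

@[simp] theorem coordIs_tup : CoordIs p q (tup i j f a d c l) ↔ p + 1 = i ∧ q + 1 = j := by
  simp [CoordIs]
@[simp] theorem flagIs_tup : FlagIs p (tup i j f a d c l) ↔ p = f := by simp [FlagIs]
@[simp] theorem aIs_tup : AIs p (tup i j f a d c l) ↔ p = a := by simp [AIs]
@[simp] theorem pdIs_tup : PdIs p (tup i j f a d c l) ↔ p = d := by simp [PdIs]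
@[simp] theorem pcIs_tup : PcIs p (tup i j f a d c l) ↔ p = c := by simp [PcIs]
@[simp] theorem labelIs_tup : LabelIs p (tup i j f a d c l) ↔ p = l := by simp [LabelIs]

end

@[simp]
theorem holds_quiescent (v : Fin 1 → M.Num) (V : Fin 0 → M.Sets) :
    quiescent.Holds M v V ↔ v 0 = qState := by
  simp [quiescent, -Fin.reduceFinMk, qState, eq_comm]

@[simp]
theorem holds_coordIs (v : Fin 3 → M.Num) (V : Fin 0 → M.Sets) :
    coordIs.Holds M v V ↔ CoordIs (v 0) (v 1) (v 2) := by
  simp [coordIs, -Fin.reduceFinMk]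
  constructor
  · rintro ⟨f, -, a, -, d, -, c, -, l, -, h⟩
    exact ⟨f, a, d, c, l, h⟩
  · rintro ⟨f, a, d, c, l, h⟩
    obtain ⟨⟨-, -, h₃, h₄, h₅, h₆, h₇⟩, -⟩ := le_of_tup_eq h
    exact ⟨f, h₃, a, h₄, d, h₅, c, h₆, l, h₇, h⟩

@[simp]
theorem holds_flagIs (v : Fin 2 → M.Num) (V : Fin 0 → M.Sets) :
    flagIs.Holds M v V ↔ FlagIs (v 0) (v 1) := by
  simp [flagIs, -Fin.reduceFinMk]
  constructor
  · rintro ⟨i, -, j, -, a, -, d, -, c, -, l, -, h⟩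
    exact ⟨i, j, a, d, c, l, h⟩
  · rintro ⟨i, j, a, d, c, l, h⟩
    obtain ⟨⟨h₁, h₂, h₃, h₄, h₅, h₆, h₇⟩, -⟩ := le_of_tup_eq h
    exact ⟨i, h₁, j, h₂, a, h₄, d, h₅, c, h₆, l, h₇, h⟩

@[simp]
theorem holds_aIs (v : Fin 2 → M.Num) (V : Fin 0 → M.Sets) :
    aIs.Holds M v V ↔ AIs (v 0) (v 1) := by
  simp [aIs, -Fin.reduceFinMk]
  constructor
  · rintro ⟨i, -, j, -, f, -, d, -, c, -, l, -, h⟩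
    exact ⟨i, j, f, d, c, l, h⟩
  · rintro ⟨i, j, f, d, c, l, h⟩
    obtain ⟨⟨h₁, h₂, h₃, h₄, h₅, h₆, h₇⟩, -⟩ := le_of_tup_eq h
    exact ⟨i, h₁, j, h₂, f, h₃, d, h₅, c, h₆, l, h₇, h⟩

@[simp]
theorem holds_pdIs (v : Fin 2 → M.Num) (V : Fin 0 → M.Sets) :
    pdIs.Holds M v V ↔ PdIs (v 0) (v 1) := by
  simp [pdIs, -Fin.reduceFinMk]
  constructor
  · rintro ⟨i, -, j, -, f, -, a, -, c, -, l, -, h⟩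
    exact ⟨i, j, f, a, c, l, h⟩
  · rintro ⟨i, j, f, a, c, l, h⟩
    obtain ⟨⟨h₁, h₂, h₃, h₄, h₅, h₆, h₇⟩, -⟩ := le_of_tup_eq h
    exact ⟨i, h₁, j, h₂, f, h₃, a, h₄, c, h₆, l, h₇, h⟩

@[simp]
theorem holds_pcIs (v : Fin 2 → M.Num) (V : Fin 0 → M.Sets) :
    pcIs.Holds M v V ↔ PcIs (v 0) (v 1) := by
  simp [pcIs, -Fin.reduceFinMk]
  constructor
  · rintro ⟨i, -, j, -, f, -, a, -, d, -, l, -, h⟩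
    exact ⟨i, j, f, a, d, l, h⟩
  · rintro ⟨i, j, f, a, d, l, h⟩
    obtain ⟨⟨h₁, h₂, h₃, h₄, h₅, h₆, h₇⟩, -⟩ := le_of_tup_eq h
    exact ⟨i, h₁, j, h₂, f, h₃, a, h₄, d, h₅, l, h₇, h⟩

@[simp]
theorem holds_labelIs (v : Fin 2 → M.Num) (V : Fin 0 → M.Sets) :
    labelIs.Holds M v V ↔ LabelIs (v 0) (v 1) := by
  simp [labelIs, -Fin.reduceFinMk]
  constructor
  · rintro ⟨i, -, j, -, f, -, a, -, d, -, c, -, h⟩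
    exact ⟨i, j, f, a, d, c, h⟩
  · rintro ⟨i, j, f, a, d, c, h⟩
    obtain ⟨⟨h₁, h₂, h₃, h₄, h₅, h₆, h₇⟩, -⟩ := le_of_tup_eq h
    exact ⟨i, h₁, j, h₂, f, h₃, a, h₄, d, h₅, c, h₆, h⟩

/-- `s ∈ S_{n,m}`; the disjuncts are those of `isState`. -/
def IsState (n m s : M.Num) : Prop :=
  ∃ i j f a d c l, tup i j f a d c l = s ∧
    ((l = 0 + 1 ∨ l = 1 + 1) ∧
        (i = 0 + 1 ∧ j = 0 + 1 ∧ f = 0 ∧ a = 0 ∧ d = 0 ∧ c = 0 ∨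
         (1 + 1 ≤ i ∧ i ≤ n + 1) ∧ j = 0 + 1 ∧ f = 0 ∧ a = 0 ∧ d = 0 ∧ c = 0 ∨
         i = 0 + 1 ∧ (1 + 1 ≤ j ∧ j ≤ m + 1) ∧ f = 0 ∧ (a = 0 + 1 ∨ a = 1 + 1) ∧ d = 0 ∧ c = 0 ∨
         i = 0 + 1 ∧ j = m + 1 + 1 ∧ f = 0 ∧ a = 0 ∧ d = 0 ∧ c = 0 ∨
         (1 + 1 ≤ i ∧ i ≤ n + 1) ∧ j = m + 1 + 1 ∧ f = 0 ∧ a = 0 ∧ d = 0 ∧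
            (c = 0 + 1 ∨ c = 1 + 1) ∨
         (1 + 1 ≤ i ∧ i ≤ n + 1) ∧ (1 + 1 ≤ j ∧ j ≤ m + 1) ∧
            (f = 1 + 1 + 1 ∨ f = 0 + 1 ∨ f = 1 + 1) ∧ (a = 0 + 1 ∨ a = 1 + 1) ∧
            (d = 0 + 1 ∨ d = 1 + 1) ∧ c = 0) ∨
      i = 0 ∧ j = 0 ∧ f = 0 ∧ a = 0 ∧ d = 0 ∧ c = 0 ∧ l = 0)

@[simp]
theorem holds_isState (v : Fin 3 → M.Num) (V : Fin 0 → M.Sets) :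
    isState.Holds M v V ↔ IsState (v 0) (v 1) (v 2) := by
  simp [isState, -Fin.reduceFinMk, -zero_add]
  constructor
  · rintro ⟨i, -, j, -, f, -, a, -, d, -, c, -, l, -, h⟩
    exact ⟨i, j, f, a, d, c, l, h⟩
  · rintro ⟨i, j, f, a, d, c, l, h⟩
    obtain ⟨⟨h₁, h₂, h₃, h₄, h₅, h₆, h₇⟩, -⟩ := le_of_tup_eq h.1
    exact ⟨i, h₁, j, h₂, f, h₃, a, h₄, d, h₅, c, h₆, l, h₇, h⟩

@[simp] theorem isSigma0B_quiescent : IsSigma0B quiescent := by simp [quiescent]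
@[simp] theorem isSigma0B_coordIs : IsSigma0B coordIs := by simp [coordIs]
@[simp] theorem isSigma0B_flagIs : IsSigma0B flagIs := by simp [flagIs]
@[simp] theorem isSigma0B_aIs : IsSigma0B aIs := by simp [aIs]
@[simp] theorem isSigma0B_pdIs : IsSigma0B pdIs := by simp [pdIs]
@[simp] theorem isSigma0B_pcIs : IsSigma0B pcIs := by simp [pcIs]
@[simp] theorem isSigma0B_labelIs : IsSigma0B labelIs := by simp [labelIs]
@[simp] theorem isSigma0B_isState : IsSigma0B isState := by simp [isState]

end Coding

/-! ### Truth of the correctness rules and of the transition function -/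

section Rules

attribute [-simp] Fin.zero_eta Fin.mk_one Fin.mk_zero Order.add_one_le_iff

variable {M : Struct.{u}}

/-- `t` is the state `s` with the label replaced by the sum of the labels of `s` and of its
successor among the neighbours `r, l, b, u`. -/
def Update (n m s r l b u t : M.Num) : Prop := update.Holds M ![n, m, s, r, l, b, u, t] ![]

@[simp]
theorem holds_update (v : Fin 8 → M.Num) (V : Fin 0 → M.Sets) :
    update.Holds M v V ↔ Update (v 0) (v 1) (v 2) (v 3) (v 4) (v 5) (v 6) (v 7) := by
  have h₁ : v = ![v 0, v 1, v 2, v 3, v 4, v 5, v 6, v 7] := by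
    funext i; fin_cases i <;> rfl
  have h₂ : V = ![] := Subsingleton.elim _ _
  rw [Update, ← h₁, h₂]

variable [V0Model M]

/-- Index consistency of the cell `(i, j)` with state `s` and neighbours `r, l, b, u`. -/
def RuleA (n m r l b u i j : M.Num) : Prop :=
  (j ≤ m → CoordIs i (j + 1) r) ∧
  (j = m + 1 → r = qState) ∧
  (∀ k, k ≤ j → k + 1 = j → CoordIs i k l) ∧
  (j = 0 → l = qState) ∧
  (i ≤ n ∧ i ≠ n → CoordIs (i + 1) j b) ∧
  (i = n → b = qState) ∧
  (∀ k, k ≤ i → k + 1 = i → CoordIs k j u) ∧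
  (i = 0 → u = qState)

/-- Formula consistency. -/
def RuleB (R : M.Sets) (n m s i j : M.Num) : Prop :=
  (1 ≤ i ∧ i ≤ n) ∧ (1 ≤ j ∧ j ≤ m) →
    (FlagIs (1 + 1) s ↔ tri i j 1 ∈ R) ∧
    (FlagIs (1 + 1 + 1) s ↔ tri i j (1 + 1) ∈ R) ∧
    (FlagIs (0 + 1) s ↔ tri i j 1 ∉ R ∧ tri i j (1 + 1) ∉ R)

/-- The rules for the `a`-value and for the last column. -/
def RuleC (m s l b u i j : M.Num) : Prop :=
  (1 ≤ j ∧ j ≤ m →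
    (b ≠ qState → ∃ k, k ≤ 1 + 1 ∧ AIs k b ∧ AIs k s) ∧
    (u ≠ qState → ∃ k, k ≤ 1 + 1 ∧ AIs k u ∧ AIs k s)) ∧
  (1 + 1 ≤ i ∧ j = m + 1 → (PcIs (1 + 1) s ↔ PcIs (1 + 1) u ∧ PdIs (1 + 1) l)) ∧
  (i = 1 ∧ j = m + 1 → (PcIs (1 + 1) s ↔ PdIs (1 + 1) l))

/-- The literal of the cell is true. -/
def LiteralTrue (s : M.Num) : Prop :=
  FlagIs (1 + 1) s ∧ AIs (1 + 1) s ∨ FlagIs (1 + 1 + 1) s ∧ AIs (0 + 1) s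

/-- The rules for the partial disjunctions. -/
def RuleD (n m s l i j : M.Num) : Prop :=
  ((1 ≤ i ∧ i ≤ n) ∧ (1 + 1 ≤ j ∧ j ≤ m) →
    (PdIs (1 + 1) s ↔ PdIs (1 + 1) l ∨ LiteralTrue s)) ∧
  ((1 ≤ i ∧ i ≤ n) ∧ j = 1 → (PdIs (1 + 1) s ↔ LiteralTrue s))

/-- The absent components are absent. -/
def RuleE (n m s i j : M.Num) : Prop :=
  (j = 0 ∨ i = 0 ∧ j = m + 1 → FlagIs 0 s ∧ AIs 0 s ∧ PdIs 0 s ∧ PcIs 0 s) ∧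
  (i = 0 ∧ 1 ≤ j ∧ j ≤ m → FlagIs 0 s ∧ PdIs 0 s ∧ PcIs 0 s) ∧
  (1 ≤ i ∧ j = m + 1 → FlagIs 0 s ∧ AIs 0 s ∧ PdIs 0 s) ∧
  ((1 ≤ i ∧ i ≤ n) ∧ (1 ≤ j ∧ j ≤ m) → PcIs 0 s)

/-- The cell with state `s` and neighbours `r, l, b, u` is blue. -/
def Blue (R : M.Sets) (n m s r l b u : M.Num) : Prop :=
  (∃ i, i ≤ n ∧ ∃ j, j ≤ m + 1 ∧ CoordIs i j s ∧ RuleA n m r l b u i j ∧ RuleB R n m s i j ∧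
    RuleC m s l b u i j ∧ RuleD n m s l i j ∧ RuleE n m s i j) ∧
  (CoordIs n (m + 1) s → PcIs (1 + 1) s)

@[simp]
theorem holds_ruleA (v : Fin 9 → M.Num) (V : Fin 1 → M.Sets) :
    ruleA.Holds M v V ↔ RuleA (v 0) (v 1) (v 3) (v 4) (v 5) (v 6) (v 7) (v 8) := by
  simp [ruleA, RuleA, -Fin.reduceFinMk]; rfl

@[simp]
theorem holds_ruleB (v : Fin 9 → M.Num) (V : Fin 1 → M.Sets) :
    ruleB.Holds M v V ↔ RuleB (V 0) (v 0) (v 1) (v 2) (v 7) (v 8) := by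
  simp [ruleB, RuleB, -Fin.reduceFinMk, -zero_add]; rfl

@[simp]
theorem holds_literalTrue (v : Fin 9 → M.Num) (V : Fin 1 → M.Sets) :
    literalTrue.Holds M v V ↔ LiteralTrue (v 2) := by
  simp [literalTrue, LiteralTrue, -Fin.reduceFinMk, -zero_add]; rfl

@[simp]
theorem holds_ruleC (v : Fin 9 → M.Num) (V : Fin 1 → M.Sets) :
    (ruleC1.Holds M v V ∧ ruleC2.Holds M v V ∧ ruleC3.Holds M v V) ↔
      RuleC (v 1) (v 2) (v 4) (v 5) (v 6) (v 7) (v 8) := by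
  simp [ruleC1, ruleC2, ruleC3, RuleC, -Fin.reduceFinMk]; rfl

@[simp]
theorem holds_ruleD (v : Fin 9 → M.Num) (V : Fin 1 → M.Sets) :
    (ruleD1.Holds M v V ∧ ruleD2.Holds M v V) ↔
      RuleD (v 0) (v 1) (v 2) (v 4) (v 7) (v 8) := by
  simp [ruleD1, ruleD2, RuleD, -Fin.reduceFinMk]; rfl

@[simp]
theorem holds_ruleE (v : Fin 9 → M.Num) (V : Fin 1 → M.Sets) :
    ruleE.Holds M v V ↔ RuleE (v 0) (v 1) (v 2) (v 7) (v 8) := by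
  simp [ruleE, RuleE, -Fin.reduceFinMk]; rfl

@[simp]
theorem holds_blue (v : Fin 7 → M.Num) (V : Fin 1 → M.Sets) :
    blue.Holds M v V ↔ Blue (V 0) (v 0) (v 1) (v 2) (v 3) (v 4) (v 5) (v 6) := by
  simp [blue, locallyCorrect, Blue, -Fin.reduceFinMk]
  refine and_congr ⟨?_, ?_⟩ Iff.rfl
  · rintro ⟨i, hi, j, hj, h, hA, hB, hC₁, hC₂, hC₃, hD₁, hD₂, hE⟩
    exact ⟨i, hi, j, hj, h, hA, hB, (holds_ruleC _ V).1 ⟨hC₁, hC₂, hC₃⟩,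
      (holds_ruleD _ V).1 ⟨hD₁, hD₂⟩, hE⟩
  · rintro ⟨i, hi, j, hj, h, hA, hB, hC, hD, hE⟩
    let w := Fin.snoc (α := fun _ => M.Num) (Fin.snoc (α := fun _ => M.Num) v i) j
    obtain ⟨hC₁, hC₂, hC₃⟩ := (holds_ruleC w V).2 hC
    obtain ⟨hD₁, hD₂⟩ := (holds_ruleD w V).2 hD
    exact ⟨i, hi, j, hj, h, hA, hB, hC₁, hC₂, hC₃, hD₁, hD₂, hE⟩

/-- A neighbour that carries the label of the cell, or has no coordinates, allows the new label
`0`, whether it is the successor or not. -/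
theorem holds_newLabel (v : Fin 6 → M.Num) (V : Fin 0 → M.Sets)
    (h : ∀ i j q, CoordIs i j (v 3) → LabelIs q (v 3) → v 4 = q) (h' : v 5 = 0 + 1) :
    newLabel.Holds M v V := by
  simp [newLabel, -Fin.reduceFinMk, -zero_add]
  intro i _ j _ i' _ j' _ q _ _ _ h₁ h₂
  exact Or.inl ⟨h _ _ _ h₁ h₂, h'⟩

/-- If all neighbours with coordinates carry the label of the cell, the new label is `0`. -/
theorem update_of_labels_eq {n m r l b u i j f a d c p : M.Num}
    (h : ∀ s' ∈ [r, l, b, u], ∀ i j q, CoordIs i j s' → LabelIs q s' → p = q) :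
    Update n m (tup i j f a d c p) r l b u (tup i j f a d c (0 + 1)) := by
  simp [Update, update, -Fin.reduceFinMk, -zero_add]
  obtain ⟨⟨h₁, h₂, h₃, h₄, h₅, h₆, h₇⟩, -⟩ := le_of_tup_eq (rfl : tup i j f a d c p = _)
  obtain ⟨⟨-, -, -, -, -, -, h₈⟩, -⟩ := le_of_tup_eq (rfl : tup i j f a d c (0 + 1) = _)
  refine ⟨h₁, h₂, h₃, h₄, h₅, h₆, h₇, h₈, ?_, ?_, ?_, ?_⟩
  all_goals
    refine holds_newLabel _ _ (h _ ?_) rfl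
    simp

/-- `f_φ(s, r, l, b, u) = t`, for the formula `R`. -/
def Transition (R : M.Sets) (n m s r l b u t : M.Num) : Prop :=
  Blue R n m s r l b u ∧ Update n m s r l b u t ∨ ¬ Blue R n m s r l b u ∧ t = s

@[simp]
theorem holds_transition (v : Fin 8 → M.Num) (V : Fin 1 → M.Sets) :
    transition.Holds M v V ↔
      Transition (V 0) (v 0) (v 1) (v 2) (v 3) (v 4) (v 5) (v 6) (v 7) := by
  simp [transition, Transition, -Fin.reduceFinMk]; rfl

@[simp] theorem isSigma0B_even : IsSigma0B even := by simp [even]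
@[simp] theorem isSigma0B_odd : IsSigma0B odd := by simp [odd]
@[simp] theorem isSigma0B_suc : IsSigma0B suc := by simp [suc]
@[simp] theorem isSigma0B_literalTrue : IsSigma0B literalTrue := by simp [literalTrue]
@[simp] theorem isSigma0B_blue : IsSigma0B blue := by
  simp [blue, locallyCorrect, ruleA, ruleB, ruleC1, ruleC2, ruleC3, ruleD1, ruleD2, ruleE]
@[simp] theorem isSigma0B_newLabel : IsSigma0B newLabel := by simp [newLabel]
@[simp] theorem isSigma0B_update : IsSigma0B update := by simp [update]
@[simp] theorem isSigma0B_transition : IsSigma0B transition := by simp [transition]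

end Rules

/-! ### The correct configuration of a satisfying assignment -/

section Cells

variable {M : Struct.{u}} [V0Model M] (m : M.Num) (R A : M.Sets)

/-- The literal with variable `x_j` in the `i`th clause of `R` is true under `A`. -/
def Lit (i j : M.Num) : Prop :=
  tri i j 1 ∈ R ∧ pr j 1 ∈ A ∨ tri i j (1 + 1) ∈ R ∧ pr j 0 ∈ A

open Classical in
/-- The code of the flag of the cell `(i, j)`. -/
noncomputable def cellFlag (i j : M.Num) : M.Num :=
  if 1 ≤ i ∧ 1 ≤ j ∧ j ≤ m then
    if tri i j 1 ∈ R then 1 + 1 else if tri i j (1 + 1) ∈ R then 1 + 1 + 1 else 0 + 1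
  else 0

open Classical in
/-- The code of the `a`-value of the cells in column `j`. -/
noncomputable def cellA (j : M.Num) : M.Num :=
  if 1 ≤ j ∧ j ≤ m then if pr j 1 ∈ A then 1 + 1 else 0 + 1 else 0

open Classical in
/-- The code of the partial disjunction of the cell `(i, j)`: one of the first `j` literals of the
clause is true. -/
noncomputable def cellPd (i j : M.Num) : M.Num :=
  if 1 ≤ i ∧ 1 ≤ j ∧ j ≤ m then
    if ∃ k, k ≤ j ∧ 1 ≤ k ∧ Lit R A i k then 1 + 1 else 0 + 1
  else 0

open Classical in
/-- The code of the partial conjunction of the cell `(i, j)`. As all clauses are true, its value is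
always `1`. -/
noncomputable def cellPc (i j : M.Num) : M.Num := if 1 ≤ i ∧ j = m + 1 then 1 + 1 else 0

/-- The correct state of the cell `(i, j)`, with a label of code `l`. -/
noncomputable def cell (i j l : M.Num) : M.Num :=
  tup (i + 1) (j + 1) (cellFlag m R i j) (cellA m A j) (cellPd m R A i j) (cellPc m i j) l

variable {m R A}

theorem one_le_iff_ne_zero_num {p : M.Num} : 1 ≤ p ↔ p ≠ 0 := by
  rw [Order.one_le_iff_pos, pos_iff_ne_zero]

theorem not_add_one_le (p : M.Num) : ¬ p + 1 ≤ p := by simp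

theorem tup_ne_qState {i j f a d c l : M.Num} (h : i ≠ 0) : tup i j f a d c l ≠ qState := by
  simp [qState, h]

theorem cell_ne_qState (i j l : M.Num) : cell m R A i j l ≠ qState := tup_ne_qState (B1 i)

theorem le_cases {n i : M.Num} (h : i ≤ n) : i = 0 ∨ 1 ≤ i ∧ i ≤ n := by
  rcases eq_or_ne i 0 with e | e
  · exact Or.inl e
  · exact Or.inr ⟨one_le_iff_ne_zero_num.2 e, h⟩

theorem column_cases {j : M.Num} (h : j ≤ m + 1) : j = 0 ∨ 1 ≤ j ∧ j ≤ m ∨ j = m + 1 := by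
  rcases le_cases h with e | e
  · exact Or.inl e
  · rcases eq_or_ne j (m + 1) with e' | e'
    · exact Or.inr (Or.inr e')
    · exact Or.inr (Or.inl ⟨e.1, B11.2 ⟨h, e'⟩⟩)

theorem isState_qState (n m : M.Num) : IsState n m qState :=
  ⟨0, 0, 0, 0, 0, 0, 0, rfl, Or.inr ⟨rfl, rfl, rfl, rfl, rfl, rfl, rfl⟩⟩

theorem cellFlag_spec {i j : M.Num} (h : 1 ≤ i ∧ 1 ≤ j ∧ j ≤ m)
    (hR : ¬ (tri i j 1 ∈ R ∧ tri i j (1 + 1) ∈ R)) :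
    (1 + 1 = cellFlag m R i j ↔ tri i j 1 ∈ R) ∧
    (1 + 1 + 1 = cellFlag m R i j ↔ tri i j (1 + 1) ∈ R) ∧
    (0 + 1 = cellFlag m R i j ↔ tri i j 1 ∉ R ∧ tri i j (1 + 1) ∉ R) := by
  rw [cellFlag, if_pos h]
  split_ifs with h₁ h₂ <;> simp_all

theorem cellA_spec {j : M.Num} (h : 1 ≤ j ∧ j ≤ m) :
    (1 + 1 = cellA m A j ↔ pr j 1 ∈ A) ∧ (0 + 1 = cellA m A j ↔ pr j 1 ∉ A) := by
  rw [cellA, if_pos h]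
  split_ifs with h₁ <;> simp_all

theorem cellPd_spec {i j : M.Num} (h : 1 ≤ i ∧ 1 ≤ j ∧ j ≤ m) :
    1 + 1 = cellPd m R A i j ↔ ∃ k, k ≤ j ∧ 1 ≤ k ∧ Lit R A i k := by
  rw [cellPd, if_pos h]
  split_ifs with h₁
  · exact iff_of_true rfl h₁
  · exact iff_of_false (by simp) h₁

theorem cellFlag_cases {i j : M.Num} (h : 1 ≤ i ∧ 1 ≤ j ∧ j ≤ m) :
    cellFlag m R i j = 1 + 1 + 1 ∨ cellFlag m R i j = 0 + 1 ∨ cellFlag m R i j = 1 + 1 := by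
  rw [cellFlag, if_pos h]
  split_ifs <;> simp

theorem cellA_cases {j : M.Num} (h : 1 ≤ j ∧ j ≤ m) :
    cellA m A j = 0 + 1 ∨ cellA m A j = 1 + 1 := by
  rw [cellA, if_pos h]
  split_ifs <;> simp

theorem cellPd_cases {i j : M.Num} (h : 1 ≤ i ∧ 1 ≤ j ∧ j ≤ m) :
    cellPd m R A i j = 0 + 1 ∨ cellPd m R A i j = 1 + 1 := by
  rw [cellPd, if_pos h]
  split_ifs <;> simp

theorem cellA_le (j : M.Num) : cellA m A j ≤ 1 + 1 := by
  rw [cellA]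
  split_ifs
  · exact le_rfl
  · exact add_le_add_left (B9 1) 1
  · exact B9 _

theorem not_one_le_zero : ¬ (1 : M.Num) ≤ 0 := by simp

theorem cellFlag_eq_zero {i j : M.Num} (h : i = 0 ∨ j = 0 ∨ j = m + 1) :
    cellFlag m R i j = 0 := by
  refine if_neg ?_
  rintro ⟨h₁, h₂, h₃⟩
  rcases h with rfl | rfl | rfl
  · exact not_one_le_zero h₁
  · exact not_one_le_zero h₂
  · exact not_add_one_le m h₃

theorem cellA_eq_zero {j : M.Num} (h : j = 0 ∨ j = m + 1) : cellA m A j = 0 := by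
  refine if_neg ?_
  rintro ⟨h₂, h₃⟩
  rcases h with rfl | rfl
  · exact not_one_le_zero h₂
  · exact not_add_one_le m h₃

theorem cellPd_eq_zero {i j : M.Num} (h : i = 0 ∨ j = 0 ∨ j = m + 1) :
    cellPd m R A i j = 0 := by
  refine if_neg ?_
  rintro ⟨h₁, h₂, h₃⟩
  rcases h with rfl | rfl | rfl
  · exact not_one_le_zero h₁
  · exact not_one_le_zero h₂
  · exact not_add_one_le m h₃

theorem cellPc_eq_zero {i j : M.Num} (h : i = 0 ∨ j ≤ m) : cellPc m i j = 0 := by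
  refine if_neg ?_
  rintro ⟨h₁, rfl⟩
  rcases h with rfl | h
  · exact not_one_le_zero h₁
  · exact not_add_one_le m h

theorem cellPc_last {i : M.Num} (h : 1 ≤ i) : cellPc m i (m + 1) = 1 + 1 := if_pos ⟨h, rfl⟩

theorem isState_cell {n i j l : M.Num} (hi : i ≤ n) (hj : j ≤ m + 1) (hl : l = 0 + 1 ∨ l = 1 + 1) :
    IsState n m (cell m R A i j l) := by
  refine ⟨_, _, _, _, _, _, _, rfl, Or.inl ⟨hl, ?_⟩⟩
  rcases le_cases hi with rfl | hi' <;> rcases column_cases hj with rfl | hj' | rfl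
  · exact Or.inl ⟨rfl, rfl, cellFlag_eq_zero (by simp), cellA_eq_zero (by simp),
      cellPd_eq_zero (by simp), cellPc_eq_zero (by simp)⟩
  · exact Or.inr (Or.inr (Or.inl ⟨rfl, ⟨add_le_add_left hj'.1 1, add_le_add_left hj'.2 1⟩,
      cellFlag_eq_zero (by simp), cellA_cases hj', cellPd_eq_zero (by simp),
      cellPc_eq_zero (by simp)⟩))
  · exact Or.inr (Or.inr (Or.inr (Or.inl ⟨rfl, rfl, cellFlag_eq_zero (by simp),
      cellA_eq_zero (by simp), cellPd_eq_zero (by simp), cellPc_eq_zero (by simp)⟩)))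
  · exact Or.inr (Or.inl ⟨⟨add_le_add_left hi'.1 1, add_le_add_left hi'.2 1⟩, rfl,
      cellFlag_eq_zero (by simp), cellA_eq_zero (by simp), cellPd_eq_zero (by simp),
      cellPc_eq_zero (Or.inr (B9 m))⟩)
  · exact Or.inr (Or.inr (Or.inr (Or.inr (Or.inr ⟨⟨add_le_add_left hi'.1 1,
      add_le_add_left hi'.2 1⟩, ⟨add_le_add_left hj'.1 1, add_le_add_left hj'.2 1⟩,
      cellFlag_cases ⟨hi'.1, hj'⟩, cellA_cases hj', cellPd_cases ⟨hi'.1, hj'⟩,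
      cellPc_eq_zero (Or.inr hj'.2)⟩))))
  · exact Or.inr (Or.inr (Or.inr (Or.inr (Or.inl ⟨⟨add_le_add_left hi'.1 1,
      add_le_add_left hi'.2 1⟩, rfl, cellFlag_eq_zero (by simp), cellA_eq_zero (by simp),
      cellPd_eq_zero (by simp), Or.inr (cellPc_last hi'.1)⟩))))

/-- `A` is a satisfying assignment of the formula `R` with `n` clauses and `m` variables, where
only those properties of the codes are listed on which the colour of the cells depends. -/
structure Satisfies (n m : M.Num) (R A : M.Sets) : Prop where
  flag_unique : ∀ i j, 1 ≤ i → i ≤ n → 1 ≤ j → j ≤ m → ¬ (tri i j 1 ∈ R ∧ tri i j (1 + 1) ∈ R)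
  value_unique : ∀ j, 1 ≤ j → j ≤ m → (pr j 0 ∈ A ↔ pr j 1 ∉ A)
  sat : ∀ i, 1 ≤ i → i ≤ n → ∃ j, j ≤ m ∧ 1 ≤ j ∧ Lit R A i j

/-- The states `r, l, b, u` are those of the neighbours of the cell `(i, j)` in the configuration
of all states `cell m R A i j p`. -/
structure Neighbours (n m : M.Num) (R A : M.Sets) (i j p r l b u : M.Num) : Prop where
  right : j ≤ m ∧ r = cell m R A i (j + 1) p ∨ j = m + 1 ∧ r = qState
  left : (∃ k, k + 1 = j ∧ l = cell m R A i k p) ∨ j = 0 ∧ l = qState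
  below : (i ≤ n ∧ i ≠ n) ∧ b = cell m R A (i + 1) j p ∨ i = n ∧ b = qState
  above : (∃ k, k + 1 = i ∧ u = cell m R A k j p) ∨ i = 0 ∧ u = qState

section Blue

variable {n i j p r l b u : M.Num}

theorem ruleA_cell (h : Neighbours n m R A i j p r l b u) : RuleA n m r l b u i j := by
  obtain ⟨hr, hl, hb, hu⟩ := h
  refine ⟨fun e => ?_, fun e => ?_, fun k _ e => ?_, fun e => ?_, fun e => ?_, fun e => ?_,
    fun k _ e => ?_, fun e => ?_⟩
  · rcases hr with ⟨-, rfl⟩ | ⟨rfl, -⟩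
    · simp [cell]
    · exact absurd e (not_add_one_le m)
  · rcases hr with ⟨e', -⟩ | ⟨-, e'⟩
    · exact absurd (e ▸ e') (not_add_one_le m)
    · exact e'
  · subst e
    rcases hl with ⟨k', e, rfl⟩ | ⟨e, -⟩
    · simp [cell, B2 e]
    · exact absurd e (B1 k)
  · subst e
    rcases hl with ⟨k', e, -⟩ | ⟨-, e⟩
    · exact absurd e (B1 k')
    · exact e
  · rcases hb with ⟨-, rfl⟩ | ⟨e', -⟩
    · simp [cell]
    · exact absurd e' e.2
  · rcases hb with ⟨⟨-, e'⟩, -⟩ | ⟨-, e'⟩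
    · exact absurd e e'
    · exact e'
  · subst e
    rcases hu with ⟨k', e, rfl⟩ | ⟨e, -⟩
    · simp [cell, B2 e]
    · exact absurd e (B1 k)
  · subst e
    rcases hu with ⟨k', e, -⟩ | ⟨-, e⟩
    · exact absurd e (B1 k')
    · exact e

theorem ruleB_cell (h : Satisfies n m R A) : RuleB R n m (cell m R A i j p) i j := by
  rintro ⟨⟨h₁, h₂⟩, h₃, h₄⟩
  simpa only [cell, flagIs_tup] using
    cellFlag_spec ⟨h₁, h₃, h₄⟩ (h.flag_unique i j h₁ h₂ h₃ h₄)

/-- All partial disjunctions in column `m` are true. -/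
theorem cellPd_last (h : Satisfies n m R A) (h₁ : 1 ≤ i) (h₂ : i ≤ n) :
    cellPd m R A i m = 1 + 1 := by
  obtain ⟨k, hk, hk', hL⟩ := h.sat i h₁ h₂
  exact ((cellPd_spec ⟨h₁, hk'.trans hk, le_rfl⟩).2 ⟨k, hk, hk', hL⟩).symm

theorem ruleC_cell (h : Satisfies n m R A) (hN : Neighbours n m R A i j p r l b u) (hi : i ≤ n) :
    RuleC m (cell m R A i j p) l b u i j := by
  have hleft : 1 ≤ i → j = m + 1 → PdIs (1 + 1) l := by
    rintro h₁ rfl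
    rcases hN.left with ⟨k, e, rfl⟩ | ⟨e, -⟩
    · rw [B2 e, cell, pdIs_tup, cellPd_last h h₁ hi]
    · exact absurd e (B1 m)
  refine ⟨fun _ => ⟨fun hb => ?_, fun hu => ?_⟩, ?_, ?_⟩
  · rcases hN.below with ⟨-, rfl⟩ | ⟨-, e⟩
    · exact ⟨_, cellA_le j, by rw [cell, aIs_tup], by rw [cell, aIs_tup]⟩
    · exact absurd e hb
  · rcases hN.above with ⟨k, -, rfl⟩ | ⟨-, e⟩
    · exact ⟨_, cellA_le j, by rw [cell, aIs_tup], by rw [cell, aIs_tup]⟩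
    · exact absurd e hu
  · rintro ⟨h₁, h₂⟩
    have h₁' : 1 ≤ i := (B8 1 1).trans h₁
    refine iff_of_true ?_ ⟨?_, hleft h₁' h₂⟩
    · rw [cell, pcIs_tup, h₂, cellPc_last h₁']
    · rcases hN.above with ⟨k, rfl, rfl⟩ | ⟨rfl, -⟩
      · rw [cell, pcIs_tup, h₂, cellPc_last (le_of_add_le_add_right h₁)]
      · exact absurd h₁' not_one_le_zero
  · rintro ⟨rfl, h₂⟩
    refine iff_of_true ?_ (hleft le_rfl h₂)
    rw [cell, pcIs_tup, h₂, cellPc_last le_rfl]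

theorem literalTrue_cell (h : Satisfies n m R A) (h₁ : 1 ≤ i) (h₂ : i ≤ n) (h₃ : 1 ≤ j)
    (h₄ : j ≤ m) : LiteralTrue (cell m R A i j p) ↔ Lit R A i j := by
  obtain ⟨e₁, e₂, -⟩ := cellFlag_spec ⟨h₁, h₃, h₄⟩ (h.flag_unique i j h₁ h₂ h₃ h₄)
  obtain ⟨e₃, e₄⟩ := cellA_spec (A := A) ⟨h₃, h₄⟩
  rw [LiteralTrue, cell, flagIs_tup, flagIs_tup, aIs_tup, aIs_tup, e₁, e₂, e₃, e₄, Lit,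
    h.value_unique j h₃ h₄]

theorem ruleD_cell (h : Satisfies n m R A) (hN : Neighbours n m R A i j p r l b u) :
    RuleD n m (cell m R A i j p) l i j := by
  refine ⟨?_, ?_⟩
  · rintro ⟨⟨h₁, h₂⟩, h₃, h₄⟩
    have h₃' : 1 ≤ j := (B8 1 1).trans h₃
    rw [literalTrue_cell h h₁ h₂ h₃' h₄, cell, pdIs_tup, cellPd_spec ⟨h₁, h₃', h₄⟩]
    rcases hN.left with ⟨k, rfl, rfl⟩ | ⟨rfl, -⟩
    · rw [cell, pdIs_tup,
        cellPd_spec ⟨h₁, le_of_add_le_add_right h₃, (B8 k 1).trans h₄⟩]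
      constructor
      · rintro ⟨q, hq, hq', hL⟩
        by_cases e : q = k + 1
        · exact Or.inr (e ▸ hL)
        · exact Or.inl ⟨q, B11.2 ⟨hq, e⟩, hq', hL⟩
      · rintro (⟨q, hq, hq', hL⟩ | hL)
        · exact ⟨q, hq.trans (B8 k 1), hq', hL⟩
        · exact ⟨k + 1, le_rfl, h₃', hL⟩
    · exact absurd h₃' not_one_le_zero
  · rintro ⟨⟨h₁, h₂⟩, rfl⟩
    -- In a table with `m = 0`, the cell `(i, 1)` lies in the last column; then no clause is true.
    by_cases hm : 1 ≤ m
    · rw [literalTrue_cell h h₁ h₂ le_rfl hm, cell, pdIs_tup, cellPd_spec ⟨h₁, le_rfl, hm⟩]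
      constructor
      · rintro ⟨q, hq, hq', hL⟩
        exact hq.antisymm hq' ▸ hL
      · exact fun hL => ⟨1, le_rfl, le_rfl, hL⟩
    · obtain ⟨k, hk, hk', -⟩ := h.sat i h₁ h₂
      exact absurd (hk'.trans hk) hm

theorem ruleE_cell : RuleE n m (cell m R A i j p) i j := by
  simp only [RuleE, cell, flagIs_tup, aIs_tup, pdIs_tup, pcIs_tup]
  refine ⟨?_, ?_, ?_, ?_⟩
  · rintro (rfl | ⟨rfl, rfl⟩)
    · exact ⟨(cellFlag_eq_zero (by simp)).symm, (cellA_eq_zero (by simp)).symm,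
        (cellPd_eq_zero (by simp)).symm, (cellPc_eq_zero (Or.inr (B9 m))).symm⟩
    · exact ⟨(cellFlag_eq_zero (by simp)).symm, (cellA_eq_zero (by simp)).symm,
        (cellPd_eq_zero (by simp)).symm, (cellPc_eq_zero (by simp)).symm⟩
  · rintro ⟨rfl, -⟩
    exact ⟨(cellFlag_eq_zero (by simp)).symm, (cellPd_eq_zero (by simp)).symm,
      (cellPc_eq_zero (by simp)).symm⟩
  · rintro ⟨-, rfl⟩
    exact ⟨(cellFlag_eq_zero (by simp)).symm, (cellA_eq_zero (by simp)).symm,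
        (cellPd_eq_zero (by simp)).symm⟩
  · rintro ⟨-, -, h⟩
    exact (cellPc_eq_zero (Or.inr h)).symm

/-- In the correct configuration, every cell is blue. At the output cell `(n, m + 1)`, this uses
that there is at least one clause: in row `0` the partial conjunction is absent. -/
theorem blue_cell (h : Satisfies n m R A) (hn : 1 ≤ n) (hN : Neighbours n m R A i j p r l b u)
    (hi : i ≤ n) (hj : j ≤ m + 1) : Blue R n m (cell m R A i j p) r l b u := by
  refine ⟨⟨i, hi, j, hj, by simp [cell], ruleA_cell hN, ruleB_cell h, ruleC_cell h hN hi,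
    ruleD_cell h hN, ruleE_cell⟩, fun e => ?_⟩
  rw [cell, coordIs_tup] at e
  rw [cell, pcIs_tup, ← B2 e.1, ← B2 e.2, cellPc_last hn]

/-- If all labels are equal, then the correct configuration is mapped to the correct configuration
with labels `0`. -/
theorem transition_cell (h : Satisfies n m R A) (hn : 1 ≤ n)
    (hN : Neighbours n m R A i j p r l b u) (hi : i ≤ n) (hj : j ≤ m + 1) :
    Transition R n m (cell m R A i j p) r l b u (cell m R A i j (0 + 1)) := by
  refine Or.inl ⟨blue_cell h hn hN hi hj, update_of_labels_eq ?_⟩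
  have hq : ∀ {s : M.Num}, s = qState → ∀ i j q, CoordIs i j s → LabelIs q s → p = q := by
    rintro s rfl i j q h₁ -
    rw [qState, coordIs_tup] at h₁
    exact absurd h₁.1 (B1 i)
  have hc : ∀ {s i' j' : M.Num}, s = cell m R A i' j' p →
      ∀ i j q, CoordIs i j s → LabelIs q s → p = q := by
    rintro s i' j' rfl i j q - h₂
    rw [cell, labelIs_tup] at h₂
    exact h₂.symm
  simp only [List.mem_cons, List.not_mem_nil, or_false]
  rintro s (rfl | rfl | rfl | rfl)
  · rcases hN.right with ⟨-, e⟩ | ⟨-, e⟩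
    exacts [hc e, hq e]
  · rcases hN.left with ⟨k, -, e⟩ | ⟨-, e⟩
    exacts [hc e, hq e]
  · rcases hN.below with ⟨-, e⟩ | ⟨-, e⟩
    exacts [hc e, hq e]
  · rcases hN.above with ⟨k, -, e⟩ | ⟨-, e⟩
    exacts [hc e, hq e]

end Blue

end Cells

/-! ### Existence of sets -/

section Existence

attribute [-simp] Fin.zero_eta Fin.mk_one Fin.mk_zero Order.add_one_le_iff

variable {M : Struct.{u}}

@[simp]
theorem holds_even (v : Fin 1 → M.Num) (V : Fin 0 → M.Sets) :
    even.Holds M v V ↔ ∃ h, h ≤ v 0 ∧ v 0 = h + h := by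
  simp [even, -Fin.reduceFinMk]

@[simp]
theorem holds_odd (v : Fin 1 → M.Num) (V : Fin 0 → M.Sets) :
    odd.Holds M v V ↔ ∃ h, h ≤ v 0 ∧ v 0 = h + h + 1 := by
  simp [odd, -Fin.reduceFinMk]

variable [V0Model M]

/-- A bounded definable property defines a set. -/
theorem Definable.exists_set_of_lt {P : M.Num → Prop} (h : Definable P) (y : M.Num)
    (hy : ∀ z, P z → z < y) : ∃ Y : M.Sets, ∀ z, z ∈ Y ↔ P z := by
  obtain ⟨Y, hY, hP⟩ := h.exists_set y
  refine ⟨Y, fun z => ?_⟩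
  by_cases hz : z < y
  · exact hP z hz.le hz.ne
  · refine iff_of_false (fun hzY => hz ?_) fun hz' => hz (hy z hz')
    exact (lt_of_le_of_ne (L1 hzY).1 (L1 hzY).2).trans_le hY

theorem tri_mono {p q r p' q' r' : M.Num} (hp : p ≤ p') (hq : q ≤ q') (hr : r ≤ r') :
    tri p q r ≤ tri p' q' r' := pr_mono hp (pr_mono hq hr)

theorem six_mono {p q r s t w p' q' r' s' t' w' : M.Num} (h₁ : p ≤ p') (h₂ : q ≤ q') (h₃ : r ≤ r')
    (h₄ : s ≤ s') (h₅ : t ≤ t') (h₆ : w ≤ w') : six p q r s t w ≤ six p' q' r' s' t' w' :=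
  pr_mono h₁ (pr_mono h₂ (pr_mono h₃ (pr_mono h₄ (pr_mono h₅ h₆))))

/-- The code of a state is bounded by a term in `n` and `m`. -/
theorem IsState.le {n m s : M.Num} (h : IsState n m s) :
    s ≤ tup (n + 1) (m + 1 + 1) (1 + 1 + 1) (1 + 1) (1 + 1) (1 + 1) (1 + 1) := by
  obtain ⟨i, j, f, a, d, c, l, rfl, h⟩ := h
  have h0 : ∀ p : M.Num, 0 ≤ p := B9
  have h1 : ∀ p q : M.Num, 0 + 1 ≤ p + q + 1 := fun p q => add_le_add_left (B9 _) 1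
  have h2 : ∀ p : M.Num, 0 + 1 ≤ p + 1 := fun p => add_le_add_left (B9 _) 1
  have bit : ∀ p : M.Num, p = 0 + 1 ∨ p = 1 + 1 → p ≤ 1 + 1 := by
    rintro p (rfl | rfl)
    exacts [h2 1, le_rfl]
  have hm : m + 1 ≤ m + 1 + 1 := B8 _ _
  refine six_mono (pr_mono (p' := n + 1) (q' := m + 1 + 1) ?_ ?_) ?_ ?_ ?_ ?_ ?_
  · rcases h with ⟨-, h | h | h | h | h | h⟩ | h
    all_goals rcases h with ⟨h, -⟩
    exacts [h ▸ h2 n, h.2, h ▸ h2 n, h ▸ h2 n, h.2, h.2, h ▸ h0 _]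
  · rcases h with ⟨-, h | h | h | h | h | h⟩ | h
    all_goals rcases h with ⟨-, h, -⟩
    exacts [h ▸ h2 _, h ▸ h2 _, h.2.trans hm, h ▸ le_rfl, h ▸ le_rfl, h.2.trans hm, h ▸ h0 _]
  · rcases h with ⟨-, h | h | h | h | h | h⟩ | h
    all_goals rcases h with ⟨-, -, h, -⟩
    iterate 5 exact h ▸ h0 _
    · rcases h with h | h | h
      exacts [h ▸ le_rfl, h ▸ h2 _, h ▸ B8 _ _]
    · exact h ▸ h0 _
  · rcases h with ⟨-, h | h | h | h | h | h⟩ | h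
    all_goals rcases h with ⟨-, -, -, h, -⟩
    exacts [h ▸ h0 _, h ▸ h0 _, bit a h, h ▸ h0 _, h ▸ h0 _, bit a h, h ▸ h0 _]
  · rcases h with ⟨-, h | h | h | h | h | h⟩ | h
    all_goals rcases h with ⟨-, -, -, -, h, -⟩
    exacts [h ▸ h0 _, h ▸ h0 _, h ▸ h0 _, h ▸ h0 _, h ▸ h0 _, bit d h, h ▸ h0 _]
  · rcases h with ⟨-, h | h | h | h | h | h⟩ | h
    iterate 4 exact h.2.2.2.2.2 ▸ h0 _
    · exact bit c h.2.2.2.2.2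
    · exact h.2.2.2.2.2 ▸ h0 _
    · exact h.2.2.2.2.2.1 ▸ h0 _
  · rcases h with ⟨h, -⟩ | h
    · exact bit l h
    · exact h.2.2.2.2.2.2 ▸ h0 _

theorem exists_stateSet (n m : M.Num) : ∃ S : M.Sets, ∀ z, z ∈ S ↔ IsState n m z :=
  Definable.exists_set_of_lt ⟨2, 0, isState, ![n, m], ![], by simp, fun z => by simp⟩ _
    fun _ hz => Order.lt_add_one_iff.2 hz.le

@[simp]
theorem holds_isStateSet (v : Fin 2 → M.Num) (V : Fin 1 → M.Sets) :
    isStateSet.Holds M v V ↔ ∀ z, z ∈ V 0 ↔ IsState (v 0) (v 1) z := by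
  simp [isStateSet, -Fin.reduceFinMk]; rfl

/-- `z` is a tuple of the graph of the local function. -/
def InLocal (R S : M.Sets) (n m z : M.Num) : Prop :=
  ∃ s r l b u t, six s r l b u t = z ∧ s ∈ S ∧ r ∈ S ∧ l ∈ S ∧ b ∈ S ∧ u ∈ S ∧ t ∈ S ∧
    Transition R n m s r l b u t

/-- The matrix of `isLocalFunction`: it says of `x 2` that it belongs to the graph of the local
function. -/
def inLocal : Fml 3 2 :=
  .exB (x 2) (.exB (x 2) (.exB (x 2) (.exB (x 2) (.exB (x 2) (.exB (x 2)
      (sextuple.app ![x 3, x 4, x 5, x 6, x 7, x 8, x 2] ![] ⋏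
        .mem (x 3) (X 1) ⋏ .mem (x 4) (X 1) ⋏ .mem (x 5) (X 1) ⋏
        .mem (x 6) (X 1) ⋏ .mem (x 7) (X 1) ⋏ .mem (x 8) (X 1) ⋏
        transition.app ![x 0, x 1, x 3, x 4, x 5, x 6, x 7, x 8] ![X 0]))))))

theorem holds_inLocal (v : Fin 3 → M.Num) (V : Fin 2 → M.Sets) :
    inLocal.Holds M v V ↔ InLocal (V 0) (V 1) (v 0) (v 1) (v 2) := by
  simp [inLocal, InLocal, -Fin.reduceFinMk]
  constructor
  · rintro ⟨s, -, r, -, l, -, b, -, u, -, t, -, h⟩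
    exact ⟨s, r, l, b, u, t, h⟩
  · rintro ⟨s, r, l, b, u, t, h⟩
    obtain ⟨⟨h₁, h₂, h₃, h₄, h₅, h₆⟩, -⟩ := le_of_six_eq h.1
    exact ⟨s, h₁, r, h₂, l, h₃, b, h₄, u, h₅, t, h₆, h⟩

@[simp]
theorem holds_isLocalFunction (v : Fin 2 → M.Num) (V : Fin 3 → M.Sets) :
    isLocalFunction.Holds M v V ↔ ∀ z, z ∈ V 2 ↔ InLocal (V 0) (V 1) (v 0) (v 1) z := by
  rw [isLocalFunction, holds_allN]
  refine forall_congr' fun z => ?_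
  rw [holds_iff]
  refine iff_congr ?_ ?_
  · simp [-Fin.reduceFinMk]; rfl
  · simp [InLocal, -Fin.reduceFinMk]
    constructor
    · rintro ⟨s, -, r, -, l, -, b, -, u, -, t, -, h⟩
      exact ⟨s, r, l, b, u, t, h⟩
    · rintro ⟨s, r, l, b, u, t, h⟩
      obtain ⟨⟨h₁, h₂, h₃, h₄, h₅, h₆⟩, -⟩ := le_of_six_eq h.1
      exact ⟨s, h₁, r, h₂, l, h₃, b, h₄, u, h₅, t, h₆, h⟩

theorem exists_localFunction (R S : M.Sets) (n m : M.Num) :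
    ∃ F : M.Sets, ∀ z, z ∈ F ↔ InLocal R S n m z := by
  refine Definable.exists_set_of_lt ⟨2, 2, inLocal, ![n, m], ![R, S], by simp [inLocal],
    fun z => by rw [holds_inLocal]; rfl⟩
    (six (M.len S) (M.len S) (M.len S) (M.len S) (M.len S) (M.len S) + 1) fun z hz => ?_
  obtain ⟨s, r, l, b, u, t, rfl, h₁, h₂, h₃, h₄, h₅, h₆, -⟩ := hz
  exact Order.lt_add_one_iff.2 (six_mono (L1 h₁).1 (L1 h₂).1 (L1 h₃).1 (L1 h₄).1 (L1 h₅).1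
    (L1 h₆).1)

/-- `z` belongs to the formula with one more copy of the last clause. -/
def InExtended (R : M.Sets) (n m n' z : M.Num) : Prop :=
  z ∈ R ∨ ∃ j, j ≤ m ∧ ∃ f, f ≤ 1 + 1 ∧ tri n j f ∈ R ∧ tri n' j f = z

@[simp]
theorem holds_oddForm (v : Fin 3 → M.Num) (V : Fin 2 → M.Sets) :
    oddForm.Holds M v V ↔
      ((∃ h, h ≤ v 0 ∧ v 0 = h + h + 1) ∧ v 2 = v 0 ∧ V 1 = V 0 ∨
        (∃ h, h ≤ v 0 ∧ v 0 = h + h) ∧ v 2 = v 0 + 1 ∧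
          ∀ z, z ∈ V 1 ↔ InExtended (V 0) (v 0) (v 1) (v 2) z) := by
  simp [oddForm, InExtended, -Fin.reduceFinMk]; rfl

theorem exists_extended (R : M.Sets) (n m n' : M.Num) :
    ∃ R' : M.Sets, ∀ z, z ∈ R' ↔ InExtended R n m n' z := by
  refine Definable.exists_set_of_lt ⟨3, 1, .mem (x 3) (X 0) ⋎ .exB (x 1) (.exB (1 + 1)
      (inRel3.app ![x 0, x 4, x 5] ![X 0] ⋏ triple.app ![x 2, x 4, x 5, x 3] ![])),
    ![n, m, n'], ![R], by simp, fun z => ?_⟩ (M.len R + tri n' m (1 + 1) + 1) fun z hz => ?_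
  · simp [InExtended, -Fin.reduceFinMk]
  · rw [Order.lt_add_one_iff]
    rcases hz with hz | ⟨j, hj, f, hf, -, rfl⟩
    · exact (L1 hz).1.trans (B8 _ _)
    · exact (tri_mono le_rfl hj hf).trans le_add_self

theorem exists_oddForm (R : M.Sets) (n m : M.Num) : ∃ (n' : M.Num) (R' : M.Sets),
    oddForm.Holds M ![n, m, n'] ![R, R'] := by
  simp only [holds_oddForm]
  obtain ⟨h, hn, e | e⟩ := num_even_or_odd n
  · obtain ⟨R', hR'⟩ := exists_extended R n m (n + 1)
    exact ⟨n + 1, R', Or.inr ⟨⟨h, hn, e⟩, rfl, hR'⟩⟩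
  · exact ⟨n, R, Or.inl ⟨⟨h, hn, e⟩, rfl, rfl⟩⟩

/-! ### The correct configuration as a set -/

/-- `x 3 = cellFlag m R i j`, with `m, i, j = x 0, x 1, x 2` and `R = X 0`. -/
def flagFml : Fml 4 1 :=
  (1 ⩽ x 1 ⋏ between 1 (x 2) (x 0)) ⋏
      (inRel3.app ![x 1, x 2, 1] ![X 0] ⋏ x 3 ≐ val 1 ⋎
        ⌐(inRel3.app ![x 1, x 2, 1] ![X 0]) ⋏
          (inRel3.app ![x 1, x 2, minusOne] ![X 0] ⋏ x 3 ≐ val minusOne ⋎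
            ⌐(inRel3.app ![x 1, x 2, minusOne] ![X 0]) ⋏ x 3 ≐ val 0)) ⋎
    ⌐(1 ⩽ x 1 ⋏ between 1 (x 2) (x 0)) ⋏ x 3 ≐ box

/-- `x 2 = cellA m A j`, with `m, j = x 0, x 1` and `A = X 0`. -/
def aFml : Fml 3 1 :=
  between 1 (x 1) (x 0) ⋏
      (inRel2.app ![x 1, 1] ![X 0] ⋏ x 2 ≐ val 1 ⋎ ⌐(inRel2.app ![x 1, 1] ![X 0]) ⋏ x 2 ≐ val 0) ⋎
    ⌐(between 1 (x 1) (x 0)) ⋏ x 2 ≐ box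

/-- One of the first `j` literals of the `i`th clause of `R` is true under `A`, with
`i, j = x 0, x 1` and `R, A = X 0, X 1`. -/
def someLit : Fml 2 2 :=
  .exB (x 1) (1 ⩽ x 2 ⋏
    (inRel3.app ![x 0, x 2, 1] ![X 0] ⋏ inRel2.app ![x 2, 1] ![X 1] ⋎
      inRel3.app ![x 0, x 2, minusOne] ![X 0] ⋏ inRel2.app ![x 2, 0] ![X 1]))

/-- `x 3 = cellPd m R A i j`, with `m, i, j = x 0, x 1, x 2` and `R, A = X 0, X 1`. -/
def pdFml : Fml 4 2 :=
  (1 ⩽ x 1 ⋏ between 1 (x 2) (x 0)) ⋏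
      (someLit.app ![x 1, x 2] ![X 0, X 1] ⋏ x 3 ≐ val 1 ⋎
        ⌐(someLit.app ![x 1, x 2] ![X 0, X 1]) ⋏ x 3 ≐ val 0) ⋎
    ⌐(1 ⩽ x 1 ⋏ between 1 (x 2) (x 0)) ⋏ x 3 ≐ box

/-- `x 3 = cellPc m i j`, with `m, i, j = x 0, x 1, x 2`. -/
def pcFml : Fml 4 0 :=
  (1 ⩽ x 1 ⋏ x 2 ≐ x 0 + 1) ⋏ x 3 ≐ val 1 ⋎ ⌐(1 ⩽ x 1 ⋏ x 2 ≐ x 0 + 1) ⋏ x 3 ≐ box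

theorem and_or_not_and_iff_eq_ite {α : Type*} (c : Prop) [Decidable c] (z s t : α) :
    c ∧ z = s ∨ ¬ c ∧ z = t ↔ z = if c then s else t := by
  split_ifs with h <;> simp [h]

@[simp]
theorem holds_flagFml (v : Fin 4 → M.Num) (V : Fin 1 → M.Sets) :
    flagFml.Holds M v V ↔ v 3 = cellFlag (v 0) (V 0) (v 1) (v 2) := by
  simp only [flagFml, cellFlag, ← and_or_not_and_iff_eq_ite]
  simp [-Fin.reduceFinMk, -zero_add]; rfl

@[simp]
theorem holds_aFml (v : Fin 3 → M.Num) (V : Fin 1 → M.Sets) :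
    aFml.Holds M v V ↔ v 2 = cellA (v 0) (V 0) (v 1) := by
  simp only [aFml, cellA, ← and_or_not_and_iff_eq_ite]
  simp [-Fin.reduceFinMk, -zero_add]; rfl

@[simp]
theorem holds_someLit (v : Fin 2 → M.Num) (V : Fin 2 → M.Sets) :
    someLit.Holds M v V ↔ ∃ k, k ≤ v 1 ∧ 1 ≤ k ∧ Lit (V 0) (V 1) (v 0) k := by
  simp [someLit, Lit, -Fin.reduceFinMk]; rfl

@[simp]
theorem holds_pdFml (v : Fin 4 → M.Num) (V : Fin 2 → M.Sets) :
    pdFml.Holds M v V ↔ v 3 = cellPd (v 0) (V 0) (V 1) (v 1) (v 2) := by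
  simp only [pdFml, cellPd, ← and_or_not_and_iff_eq_ite]
  simp [-Fin.reduceFinMk, -zero_add, -not_exists]; rfl

@[simp]
theorem holds_pcFml (v : Fin 4 → M.Num) (V : Fin 0 → M.Sets) :
    pcFml.Holds M v V ↔ v 3 = cellPc (v 0) (v 1) (v 2) := by
  simp only [pcFml, cellPc, ← and_or_not_and_iff_eq_ite]
  simp [-Fin.reduceFinMk]; rfl

@[simp] theorem isSigma0B_flagFml : IsSigma0B flagFml := by simp [flagFml]
@[simp] theorem isSigma0B_aFml : IsSigma0B aFml := by simp [aFml]
@[simp] theorem isSigma0B_someLit : IsSigma0B someLit := by simp [someLit]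
@[simp] theorem isSigma0B_pdFml : IsSigma0B pdFml := by simp [pdFml]
@[simp] theorem isSigma0B_pcFml : IsSigma0B pcFml := by simp [pcFml]

/-- `x 3` belongs to the graph of the correct configuration with labels of code `x 2`, where
`n, m = x 0, x 1` and `R, A = X 0, X 1`. -/
def cellFml : Fml 4 2 :=
  .exB (x 0) (.exB (x 1 + 1) (.exB (x 3) (.exB (x 3) (.exB (x 3) (.exB (x 3) (.exB (x 3)
    (tuple.app ![val (x 4), val (x 5), x 6, x 7, x 8, x 9, x 2, x 10] ![] ⋏
      triple.app ![x 4, x 5, x 10, x 3] ![] ⋏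
      flagFml.app ![x 1, x 4, x 5, x 6] ![X 0] ⋏ aFml.app ![x 1, x 5, x 7] ![X 1] ⋏
      pdFml.app ![x 1, x 4, x 5, x 8] ![X 0, X 1] ⋏ pcFml.app ![x 1, x 4, x 5, x 9] ![])))))))

theorem holds_cellFml (v : Fin 4 → M.Num) (V : Fin 2 → M.Sets) :
    cellFml.Holds M v V ↔ ∃ i, i ≤ v 0 ∧ ∃ j, j ≤ v 1 + 1 ∧
      tri i j (cell (v 1) (V 0) (V 1) i j (v 2)) = v 3 := by
  simp [cellFml, -Fin.reduceFinMk]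
  constructor
  · rintro ⟨i, hi, j, hj, -, -, -, -, -, h⟩
    exact ⟨i, hi, j, hj, h⟩
  · rintro ⟨i, hi, j, hj, h⟩
    obtain ⟨-, -, hs, -⟩ := le_of_tri_eq h
    obtain ⟨⟨-, -, h₃, h₄, h₅, h₆, -⟩, -⟩ := le_of_tup_eq (rfl : cell _ _ _ i j _ = _)
    exact ⟨i, hi, j, hj, h₃.trans hs, h₄.trans hs, h₅.trans hs, h₆.trans hs, hs, h⟩

theorem exists_cellConfig (R A : M.Sets) (n m : M.Num) {p : M.Num} (hp : p = 0 + 1 ∨ p = 1 + 1) :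
    ∃ C : M.Sets, ∀ z, z ∈ C ↔
      ∃ i, i ≤ n ∧ ∃ j, j ≤ m + 1 ∧ tri i j (cell m R A i j p) = z := by
  refine Definable.exists_set_of_lt ⟨3, 2, cellFml, ![n, m, p], ![R, A], by simp [cellFml],
    fun z => by rw [holds_cellFml]; rfl⟩ (tri n (m + 1) (tup (n + 1) (m + 1 + 1)
      (1 + 1 + 1) (1 + 1) (1 + 1) (1 + 1) (1 + 1)) + 1) fun z hz => ?_
  obtain ⟨i, hi, j, hj, rfl⟩ := hz
  exact Order.lt_add_one_iff.2 (tri_mono hi hj (isState_cell hi hj hp).le)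

/-! ### Configurations and their images -/

@[simp]
theorem holds_isConfig (v : Fin 2 → M.Num) (V : Fin 2 → M.Sets) :
    isConfig.Holds M v V ↔
      (∀ z ∈ V 1, ∃ i, i ≤ v 0 ∧ ∃ j, j ≤ v 1 + 1 ∧ ∃ s, s ≤ z ∧
        tri i j s = z ∧ s ∈ V 0 ∧ s ≠ qState) ∧
      ∀ i, i ≤ v 0 → ∀ j, j ≤ v 1 + 1 → (∃ s, tri i j s ∈ V 1) ∧
        ∀ s s', tri i j s ∈ V 1 ∧ tri i j s' ∈ V 1 → s = s' := by
  simp [isConfig, -Fin.reduceFinMk]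
  rfl

/-- `s` is the state of the right neighbour of the cell `(i, j)` in `C`. -/
def RightState (C : M.Sets) (m i j s : M.Num) : Prop :=
  j ≤ m ∧ tri i (j + 1) s ∈ C ∨ j = m + 1 ∧ s = qState
/-- `s` is the state of the left neighbour of the cell `(i, j)` in `C`. -/
def LeftState (C : M.Sets) (i j s : M.Num) : Prop :=
  (∃ k, k ≤ j ∧ k + 1 = j ∧ tri i k s ∈ C) ∨ j = 0 ∧ s = qState
/-- `s` is the state of the below neighbour of the cell `(i, j)` in `C`. -/
def BelowState (C : M.Sets) (n i j s : M.Num) : Prop :=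
  (i ≤ n ∧ i ≠ n) ∧ tri (i + 1) j s ∈ C ∨ i = n ∧ s = qState
/-- `s` is the state of the above neighbour of the cell `(i, j)` in `C`. -/
def AboveState (C : M.Sets) (i j s : M.Num) : Prop :=
  (∃ k, k ≤ i ∧ k + 1 = i ∧ tri k j s ∈ C) ∨ i = 0 ∧ s = qState

@[simp]
theorem holds_rightState (v : Fin 5 → M.Num) (V : Fin 1 → M.Sets) :
    rightState.Holds M v V ↔ RightState (V 0) (v 1) (v 2) (v 3) (v 4) := by
  simp [rightState, RightState, -Fin.reduceFinMk]; rfl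

@[simp]
theorem holds_leftState (v : Fin 5 → M.Num) (V : Fin 1 → M.Sets) :
    leftState.Holds M v V ↔ LeftState (V 0) (v 2) (v 3) (v 4) := by
  simp [leftState, LeftState, -Fin.reduceFinMk]; rfl

@[simp]
theorem holds_belowState (v : Fin 5 → M.Num) (V : Fin 1 → M.Sets) :
    belowState.Holds M v V ↔ BelowState (V 0) (v 0) (v 2) (v 3) (v 4) := by
  simp [belowState, BelowState, -Fin.reduceFinMk]; rfl

@[simp]
theorem holds_aboveState (v : Fin 5 → M.Num) (V : Fin 1 → M.Sets) :
    aboveState.Holds M v V ↔ AboveState (V 0) (v 2) (v 3) (v 4) := by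
  simp [aboveState, AboveState, -Fin.reduceFinMk]; rfl

@[simp]
theorem holds_isImage (v : Fin 2 → M.Num) (V : Fin 3 → M.Sets) :
    isImage.Holds M v V ↔ ∀ i, i ≤ v 0 → ∀ j, j ≤ v 1 + 1 → ∀ s r l b u t,
      tri i j s ∈ V 1 ∧ RightState (V 1) (v 1) i j r ∧ LeftState (V 1) i j l ∧
        BelowState (V 1) (v 0) i j b ∧ AboveState (V 1) i j u ∧ tri i j t ∈ V 2 →
      six s r l b u t ∈ V 0 := by
  have h : ∀ z, z ≤ M.len (V 0) ∧ z ∈ V 0 ↔ z ∈ V 0 := fun z =>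
    and_iff_right_of_imp fun hz => (L1 hz).1
  simp [isImage, -Fin.reduceFinMk, h]; rfl

end Existence

/-! ### Two configurations with the same image -/

section Main

attribute [-simp] Fin.zero_eta Fin.mk_one Fin.mk_zero Order.add_one_le_iff

variable {M : Struct.{u}} [V0Model M]

/-- The set `C` is the correct configuration with labels of code `p`. -/
def IsCellConfig (C R A : M.Sets) (n m p : M.Num) : Prop :=
  ∀ z, z ∈ C ↔ ∃ i, i ≤ n ∧ ∃ j, j ≤ m + 1 ∧ tri i j (cell m R A i j p) = z

section Config

variable {C D R A S F : M.Sets} {n m p : M.Num}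

theorem IsCellConfig.tri_mem (h : IsCellConfig C R A n m p) {i j s : M.Num} :
    tri i j s ∈ C ↔ i ≤ n ∧ j ≤ m + 1 ∧ s = cell m R A i j p := by
  rw [h]
  constructor
  · rintro ⟨i', hi, j', hj, e⟩
    obtain ⟨rfl, rfl, rfl⟩ := tri_inj.1 e
    exact ⟨hi, hj, rfl⟩
  · rintro ⟨hi, hj, rfl⟩
    exact ⟨i, hi, j, hj, rfl⟩

theorem IsCellConfig.isConfig (h : IsCellConfig C R A n m p) (hp : p = 0 + 1 ∨ p = 1 + 1)
    (hS : ∀ z, z ∈ S ↔ IsState n m z) : isConfig.Holds M ![n, m] ![S, C] := by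
  rw [holds_isConfig]
  refine ⟨fun z hz => ?_, fun i hi j hj => ⟨⟨_, h.tri_mem.2 ⟨hi, hj, rfl⟩⟩, fun s s' hs => ?_⟩⟩
  · obtain ⟨i, hi, j, hj, e⟩ := (h z).1 hz
    exact ⟨i, hi, j, hj, _, (le_of_tri_eq e).2.2.1, e, (hS _).2 (isState_cell hi hj hp),
      cell_ne_qState i j p⟩
  · exact (h.tri_mem.1 hs.1).2.2.trans (h.tri_mem.1 hs.2).2.2.symm

theorem IsCellConfig.neighbours (h : IsCellConfig C R A n m p) {i j r l b u : M.Num}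
    (hr : RightState C m i j r) (hl : LeftState C i j l) (hb : BelowState C n i j b)
    (hu : AboveState C i j u) : Neighbours n m R A i j p r l b u := by
  refine ⟨hr.imp_left fun hr => ⟨hr.1, (h.tri_mem.1 hr.2).2.2⟩, hl.imp_left ?_,
    hb.imp_left fun hb => ⟨hb.1, (h.tri_mem.1 hb.2).2.2⟩, hu.imp_left ?_⟩
  · rintro ⟨k, -, hk, hl⟩
    exact ⟨k, hk, (h.tri_mem.1 hl).2.2⟩
  · rintro ⟨k, -, hk, hu⟩
    exact ⟨k, hk, (h.tri_mem.1 hu).2.2⟩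

theorem Neighbours.isState {i j r l b u : M.Num} (hN : Neighbours n m R A i j p r l b u)
    (hi : i ≤ n) (hj : j ≤ m + 1) (hp : p = 0 + 1 ∨ p = 1 + 1) :
    IsState n m r ∧ IsState n m l ∧ IsState n m b ∧ IsState n m u := by
  refine ⟨?_, ?_, ?_, ?_⟩
  · rcases hN.right with ⟨h, rfl⟩ | ⟨-, rfl⟩
    exacts [isState_cell hi (add_le_add_left h 1) hp, isState_qState n m]
  · rcases hN.left with ⟨k, rfl, rfl⟩ | ⟨-, rfl⟩
    exacts [isState_cell hi ((B8 k 1).trans hj) hp, isState_qState n m]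
  · rcases hN.below with ⟨h, rfl⟩ | ⟨-, rfl⟩
    exacts [isState_cell (Order.add_one_le_of_lt (lt_of_le_of_ne h.1 h.2)) hj hp,
      isState_qState n m]
  · rcases hN.above with ⟨k, rfl, rfl⟩ | ⟨-, rfl⟩
    exacts [isState_cell ((B8 k 1).trans hi) hj hp, isState_qState n m]

theorem IsCellConfig.isImage (hC : IsCellConfig C R A n m p) (hD : IsCellConfig D R A n m (0 + 1))
    (hp : p = 0 + 1 ∨ p = 1 + 1) (hn : 1 ≤ n) (h : Satisfies n m R A)
    (hS : ∀ z, z ∈ S ↔ IsState n m z) (hF : ∀ z, z ∈ F ↔ InLocal R S n m z) :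
    isImage.Holds M ![n, m] ![F, C, D] := by
  rw [holds_isImage]
  rintro i hi j hj s r l b u t ⟨hs, hr, hl, hb, hu, ht⟩
  obtain rfl := (hC.tri_mem.1 hs).2.2
  obtain rfl := (hD.tri_mem.1 ht).2.2
  have hN := hC.neighbours hr hl hb hu
  obtain ⟨h₁, h₂, h₃, h₄⟩ := hN.isState hi hj hp
  exact (hF _).2 ⟨_, _, _, _, _, _, rfl, (hS _).2 (isState_cell hi hj hp), (hS _).2 h₁,
    (hS _).2 h₂, (hS _).2 h₃, (hS _).2 h₄, (hS _).2 (isState_cell hi hj (Or.inl rfl)),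
    transition_cell h hn hN hi hj⟩

/-- The automaton of a satisfiable formula is not injective: the two correct configurations with
constant labels `0` and `1` have the same image. -/
theorem not_isInjective (hn : 1 ≤ n) (h : Satisfies n m R A)
    (hS : ∀ z, z ∈ S ↔ IsState n m z) (hF : ∀ z, z ∈ F ↔ InLocal R S n m z) :
    ¬ isInjective.Holds M ![n, m] ![S, F] := by
  intro hinj
  obtain ⟨C, hC⟩ := exists_cellConfig R A n m (p := 0 + 1) (Or.inl rfl)
  obtain ⟨D, hD⟩ := exists_cellConfig R A n m (p := 1 + 1) (Or.inr rfl)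
  replace hC : IsCellConfig C R A n m (0 + 1) := hC
  replace hD : IsCellConfig D R A n m (1 + 1) := hD
  have hCc := hC.isConfig (Or.inl rfl) hS
  have hDc := hD.isConfig (Or.inr rfl) hS
  have hCi := hC.isImage hC (Or.inl rfl) hn h hS hF
  have hDi := hD.isImage hC (Or.inr rfl) hn h hS hF
  have e : C = D := by
    simp only [isInjective, holds_allS, holds_imp, holds_and, Fml.holds_app, holds_eqS] at hinj
    have := hinj C D C
    rw [holds_isConfig] at hCc hDc
    rw [holds_isImage] at hCi hDi
    simp only [holds_isConfig, holds_isImage] at this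
    exact this ⟨hCc, hDc, hCc, hCi, hDi⟩
  have h₀ : tri 0 0 (cell m R A 0 0 (0 + 1)) ∈ C := hC.tri_mem.2 ⟨B9 _, B9 _, rfl⟩
  rw [e, hD.tri_mem] at h₀
  simpa [cell] using h₀.2.2

end Config

/-! ### Satisfying assignments -/

@[simp]
theorem holds_cnf (v : Fin 2 → M.Num) (V : Fin 1 → M.Sets) :
    cnf.Holds M v V ↔
      (∀ z, z ∈ V 0 → ∃ i, i ≤ v 0 ∧ ∃ j, j ≤ v 1 ∧ ∃ f, f ≤ 1 + 1 ∧
        1 ≤ i ∧ 1 ≤ j ∧ tri i j f = z) ∧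
      ∀ i, i ≤ v 0 → ∀ j, j ≤ v 1 → 1 ≤ i ∧ 1 ≤ j →
        (∃ f, f ≤ 1 + 1 ∧ tri i j f ∈ V 0) ∧
        ∀ f, f ≤ 1 + 1 → ∀ f', f' ≤ 1 + 1 → tri i j f ∈ V 0 ∧ tri i j f' ∈ V 0 → f = f' := by
  simp [cnf, -Fin.reduceFinMk]; rfl

@[simp]
theorem holds_assignment (v : Fin 1 → M.Num) (V : Fin 1 → M.Sets) :
    assignment.Holds M v V ↔
      (∀ z, z ∈ V 0 → ∃ j, j ≤ v 0 ∧ ∃ c, c ≤ 1 ∧ 1 ≤ j ∧ pr j c = z) ∧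
      ∀ j, j ≤ v 0 → 1 ≤ j →
        (∃ c, c ≤ 1 ∧ pr j c ∈ V 0) ∧
        ∀ c, c ≤ 1 → ∀ c', c' ≤ 1 → pr j c ∈ V 0 ∧ pr j c' ∈ V 0 → c = c' := by
  simp [assignment, -Fin.reduceFinMk]

@[simp]
theorem holds_sat (v : Fin 2 → M.Num) (V : Fin 2 → M.Sets) :
    sat.Holds M v V ↔ ∀ i, i ≤ v 0 → 1 ≤ i → ∃ j, j ≤ v 1 ∧ 1 ≤ j ∧ Lit (V 0) (V 1) i j := by
  simp [sat, Lit, -Fin.reduceFinMk]; rfl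

theorem satisfies_of_sat {R A : M.Sets} {n m : M.Num} (hR : cnf.Holds M ![n, m] ![R])
    (hA : assignment.Holds M ![m] ![A]) (h : sat.Holds M ![n, m] ![R, A]) :
    Satisfies n m R A := by
  rw [holds_cnf] at hR
  rw [holds_assignment] at hA
  rw [holds_sat] at h
  refine ⟨fun i j h₁ h₂ h₃ h₄ hf => ?_, fun j h₁ h₂ => ?_, fun i h₁ h₂ => h i h₂ h₁⟩
  · have := (hR.2 i h₂ j h₄ ⟨h₁, h₃⟩).2 1 (B8 1 1) (1 + 1) le_rfl hf
    simp at this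
  · obtain ⟨⟨c, hc, hc'⟩, hu⟩ := hA.2 j h₂ h₁
    constructor
    · intro h₀ h₁
      exact zero_ne_one (hu 0 (B9 1) 1 le_rfl ⟨h₀, h₁⟩)
    · intro h₁
      rcases le_cases hc with rfl | ⟨hc₁, -⟩
      · exact hc'
      · exact absurd (hc.antisymm hc₁ ▸ hc') h₁

/-- The copy of the last clause has the same literals as the last clause. -/
theorem Satisfies.extend {R R' A : M.Sets} {n m : M.Num} (hR : cnf.Holds M ![n, m] ![R])
    (hR' : ∀ z, z ∈ R' ↔ InExtended R n m (n + 1) z) (hn : 1 ≤ n) (h : Satisfies n m R A) :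
    Satisfies (n + 1) m R' A := by
  rw [holds_cnf] at hR
  have hold : ∀ i j f, i ≤ n → (tri i j f ∈ R' ↔ tri i j f ∈ R) := by
    intro i j f hi
    rw [hR']
    refine ⟨?_, Or.inl⟩
    rintro (h | ⟨j', -, f', -, -, e⟩)
    · exact h
    · exact absurd ((tri_inj.1 e).1 ▸ hi) (not_add_one_le n)
  have hnew : ∀ j f, j ≤ m → f ≤ 1 + 1 → (tri (n + 1) j f ∈ R' ↔ tri n j f ∈ R) := by
    intro j f hj hf
    rw [hR']
    constructor
    · rintro (h | ⟨j', -, f', -, h, e⟩)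
      · obtain ⟨i', hi', j', -, f', -, -, -, e⟩ := hR.1 _ h
        exact absurd ((tri_inj.1 e).1 ▸ hi') (not_add_one_le n)
      · obtain ⟨-, rfl, rfl⟩ := tri_inj.1 e
        exact h
    · exact fun h => Or.inr ⟨j, hj, f, hf, h, rfl⟩
  refine ⟨fun i j h₁ h₂ h₃ h₄ => ?_, h.value_unique, fun i h₁ h₂ => ?_⟩
  · by_cases e : i = n + 1
    · rw [e, hnew j _ h₄ (B8 1 1), hnew j _ h₄ le_rfl]
      exact h.flag_unique n j hn le_rfl h₃ h₄
    · have hi := B11.2 ⟨h₂, e⟩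
      rw [hold i j _ hi, hold i j _ hi]
      exact h.flag_unique i j h₁ hi h₃ h₄
  · by_cases e : i = n + 1
    · obtain ⟨j, hj, hj', hL⟩ := h.sat n hn le_rfl
      refine ⟨j, hj, hj', ?_⟩
      rwa [Lit, e, hnew j _ hj (B8 1 1), hnew j _ hj le_rfl]
    · have hi := B11.2 ⟨h₂, e⟩
      obtain ⟨j, hj, hj', hL⟩ := h.sat i h₁ hi
      refine ⟨j, hj, hj', ?_⟩
      rwa [Lit, hold i j _ hi, hold i j _ hi]

theorem Satisfies.oddForm {R R' A : M.Sets} {n m n' : M.Num} (hR : cnf.Holds M ![n, m] ![R])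
    (ho : oddForm.Holds M ![n, m, n'] ![R, R']) (hn : 1 ≤ n) (h : Satisfies n m R A) :
    1 ≤ n' ∧ Satisfies n' m R' A := by
  rw [holds_oddForm] at ho
  rcases ho with ⟨-, e₁, e₂⟩ | ⟨-, e₁, e₂⟩
  · obtain rfl : n' = n := e₁
    obtain rfl : R' = R := e₂
    exact ⟨hn, h⟩
  · obtain rfl : n' = n + 1 := e₁
    exact ⟨hn.trans (B8 n 1), h.extend hR e₂ hn⟩

end Main

end TwoSorted

open TwoSorted in
theorem mainTheorem2 : TwoSorted.Theory.Proves.{u} TwoSorted.V0 TwoSorted.injectiveImpliesUnsat := by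
  intro M hM
  have : V0Model M := ⟨hM⟩
  simp only [injectiveImpliesUnsat, isAutomaton, unsat, holds_allN, holds_allS, holds_imp,
    holds_and, holds_exN, holds_exS, holds_not, holds_le, Fml.holds_app]
  rintro n m R ⟨hn, hR⟩
  replace hn : 1 ≤ n := hn
  replace hR : cnf.Holds M ![n, m] ![R] := by
    rw [holds_cnf] at hR ⊢
    exact hR
  constructor
  · obtain ⟨n', R', ho⟩ := exists_oddForm R n m
    obtain ⟨S, hS⟩ := exists_stateSet n' m
    obtain ⟨F, hF⟩ := exists_localFunction R' S n' m
    rw [holds_oddForm] at ho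
    exact ⟨n', R', S, F, (holds_oddForm _ _).2 ho, (holds_isStateSet _ _).2 hS,
      (holds_isLocalFunction _ _).2 hF⟩
  · rintro n' R' S F ⟨ho, hS, hF⟩ hinj ⟨A, hA, hsat⟩
    replace ho : oddForm.Holds M ![n, m, n'] ![R, R'] := by
      rw [holds_oddForm] at ho ⊢
      exact ho
    replace hA : assignment.Holds M ![m] ![A] := by
      rw [holds_assignment] at hA ⊢
      exact hA
    replace hsat : sat.Holds M ![n, m] ![R, A] := by
      rw [holds_sat] at hsat ⊢
      exact hsat
    rw [holds_isStateSet] at hS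
    rw [holds_isLocalFunction] at hF
    obtain ⟨hn', h⟩ := (satisfies_of_sat hR hA hsat).oddForm hR ho hn
    refine not_isInjective (S := S) (F := F) hn' h hS hF ?_
    convert hinj using 1
    · funext i
      fin_cases i <;> rfl
    · funext i
      fin_cases i <;> rfl
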